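/- For $\alpha,\beta>0$ let $U_1,U_2,\dots$ be i.i.d. $\mathrm{Beta}(1,\alpha)$ and put $V_n=(1-U_1)\cdots(1-U_{n-1})U_n$ for $n\ge 1$. Given $(V_1,V_2,\dots)$, let $W_1,W_2,\dots$ be conditionally independent, with $W_n$ distributed as $\mathrm{Beta}\big(\beta V_n,\ \beta(1-\sum_{k=1}^n V_k)\big)$, and put $Z_n=(1-W_1)\cdots(1-W_{n-1})W_n$. Let $Q_{\alpha,\beta}$ be the law of $(Z_1,Z_2,\dots)$ on $$\triangle_\infty=\Big\{\mathbf p\in[0,1]^{\infty}:\ \sum_{i=1}^\infty p_i\le 1\Big\},$$ equipped with the subspace topology of the product space $[0,1]^\infty$. Theorem. Let $\alpha\to\infty$ and $\beta\to\infty$ with $\alpha/\beta\to c\in(0,\infty)$. Then the family $\{Q_{\alpha,\beta}:\alpha>0,\beta>0\}$ satisfies a large deviation principle on $\triangle_\infty$ with speed $\gamma=\max\{\alpha,\beta\}$ and good rate function $$I(\mathbf z)=\sup_{m\ge1} I_m(z_1,\dots,z_m)\in[0,\infty];$$ that is, $\gamma\to\infty$, the set $\{\mathbf z\in\triangle_\infty: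 I(\mathbf z)\le r\}$ is compact for every finite $r\ge0$, and for every measurable $G\subset\triangle_\infty$ with interior $G^\circ$ and closure $\bar G$, $$-\inf_{\mathbf z\in G^\circ}I(\mathbf z)\le\liminf\frac1\gamma\log Q_{\alpha,\beta}(G)\le\limsup\frac1\gamma\log Q_{\alpha,\beta}(G)\le-\inf_{\mathbf z\in\bar G}I(\mathbf z).$$ Here $$I_m(z_1,\dots,z_m)=\inf\sum_{i=1}^m\Big(a\log\frac1{1-u_i}+b\prod_{j=1}^{i-1}(1-u_j)\,h(u_i,w_i)\Big),$$ where the infimum is over all $u_i,w_i\in[0,1]$ $(1\le i\le m)$ with $u_i<1$ and $(1-w_1)\cdots(1-w_{i-1})w_i=z_i$ for all $1\le i\le m$, empty products equal $1$, $$h(u,w)=u\log\frac uw+(1-u)\log\frac{1-u}{1-w}$$ with the conventions $0\log\frac0y=0$ for $y\ge 0$ and $x\log\frac x0=\infty$ for $x>0$, and $$(a,b)=\begin{cases}(c,1),&c<1,\\(1,c^{-1}),&c>1,\\(1,1),&c=1.\end{cases}$$ -/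

import Mathlib

open MeasureTheory ProbabilityTheory Filter Topology Set
open scoped ENNReal

noncomputable section

namespace HDP

/-! ### Large deviation principles -/

/-- The family of measures `P i` on the topological space `S` satisfies, along the filter `l`,
a large deviation principle with speed `a` and good rate function `I : S → [0, ∞]`. -/
structure SatisfiesLDP {ι S : Type*} [TopologicalSpace S] [MeasurableSpace S]
    (l : Filter ι) (P : ι → Measure S) (a : ι → ℝ) (I : S → EReal) : Prop where
  speed_tendsto : Tendsto a l atTop
  rate_nonneg : ∀ s, 0 ≤ I s
  isCompact_sublevel : ∀ r : ℝ, 0 ≤ r → IsCompact {s | I s ≤ (r : EReal)}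
  lower_bound : ∀ G : Set S, MeasurableSet G →
    -(⨅ s ∈ interior G, I s) ≤
      liminf (fun i => (((a i)⁻¹ : ℝ) : EReal) * ENNReal.log (P i G)) l
  liminf_le_limsup : ∀ G : Set S, MeasurableSet G →
    liminf (fun i => (((a i)⁻¹ : ℝ) : EReal) * ENNReal.log (P i G)) l ≤
      limsup (fun i => (((a i)⁻¹ : ℝ) : EReal) * ENNReal.log (P i G)) l
  upper_bound : ∀ G : Set S, MeasurableSet G →
    limsup (fun i => (((a i)⁻¹ : ℝ) : EReal) * ENNReal.log (P i G)) l ≤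
      -(⨅ s ∈ closure G, I s)

/-! ### The infinite simplex and stick breaking -/

/-- The space `{p ∈ [0,1]^∞ : ∑ p_i ≤ 1}`, with the topology and the σ-algebra inherited from
the product `ℕ → ℝ`. Indices start at `0`. -/
def simplexInf : Set (ℕ → ℝ) :=
  {p | (∀ i, p i ∈ Icc (0 : ℝ) 1) ∧ Summable p ∧ ∑' i, p i ≤ 1}

/-- The stick-breaking weights `(1 - w_1) ⋯ (1 - w_{i-1}) w_i`, for finite (`ι = Fin m`) or
infinite (`ι = ℕ`) sequences. -/
def stick {ι : Type*} [Preorder ι] [LocallyFiniteOrderBot ι] (w : ι → unitInterval) (i : ι) : ℝ :=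
  (∏ j ∈ Finset.Iio i, (1 - (w j : ℝ))) * w i

lemma stick_nonneg {ι : Type*} [Preorder ι] [LocallyFiniteOrderBot ι] (w : ι → unitInterval) (i : ι) :
    0 ≤ stick w i :=
  mul_nonneg (Finset.prod_nonneg fun j _ => by linarith [(w j).2.2]) (w i).2.1

lemma sum_range_stick (w : ℕ → unitInterval) (n : ℕ) :
    ∑ i ∈ Finset.range n, stick w i = 1 - ∏ i ∈ Finset.range n, (1 - (w i : ℝ)) := by
  induction n with
  | zero => simp
  | succ n ih =>
    rw [Finset.sum_range_succ, ih, Finset.prod_range_succ, stick, Nat.Iio_eq_range]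
    ring

lemma sum_range_stick_le_one (w : ℕ → unitInterval) (n : ℕ) :
    ∑ i ∈ Finset.range n, stick w i ≤ 1 := by
  rw [sum_range_stick]
  have : 0 ≤ ∏ i ∈ Finset.range n, (1 - (w i : ℝ)) :=
    Finset.prod_nonneg fun j _ => by linarith [(w j).2.2]
  linarith

lemma stick_mem (w : ℕ → unitInterval) : stick w ∈ simplexInf := by
  refine ⟨fun i => ⟨stick_nonneg w i, ?_⟩,
    summable_of_sum_range_le (stick_nonneg w) (sum_range_stick_le_one w),
    Real.tsum_le_of_sum_range_le (stick_nonneg w) (sum_range_stick_le_one w)⟩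
  refine le_trans ?_ (sum_range_stick_le_one w (i + 1))
  exact Finset.single_le_sum (f := stick w) (fun j _ => stick_nonneg w j)
    (Finset.self_mem_range_succ i)

/-- Stick breaking as a map into the infinite simplex. -/
def stickBreaking (w : ℕ → unitInterval) : simplexInf := ⟨stick w, stick_mem w⟩

lemma measurable_stickBreaking : Measurable stickBreaking := by
  refine Measurable.subtype_mk (measurable_pi_lambda _ fun i => ?_)
  unfold stick
  fun_prop

/-! ### Beta distributions on the unit interval -/

/-- The `Beta(a, b)` distribution as a measure on `[0,1]`. For positive parameters the measure
`betaMeasure a b` on `ℝ` is carried by `(0,1)`, where the projection to `[0,1]` is the identity.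
For other parameters we use the point masses `δ₁` (`a > 0`, `b ≤ 0`) and `δ₀` (`a ≤ 0`). -/
def betaLaw (a b : ℝ) : Measure unitInterval :=
  if 0 < a ∧ 0 < b then (betaMeasure a b).map (Set.projIcc (0 : ℝ) 1 zero_le_one)
  else if 0 < a then Measure.dirac 1 else Measure.dirac 0

instance (a b : ℝ) : IsProbabilityMeasure (betaLaw a b) := by
  unfold betaLaw
  split_ifs with h h'
  · have := isProbabilityMeasureBeta h.1 h.2
    exact Measure.isProbabilityMeasure_map continuous_projIcc.measurable.aemeasurable
  · infer_instance
  · infer_instance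

lemma measurable_gamma_indicator : Measurable ((Ioi (0 : ℝ)).indicator Real.Gamma) := by
  classical
  have h : ContinuousOn Real.Gamma (Ioi 0) := fun x hx =>
    (Real.differentiableAt_Gamma fun m => by
      have : (0 : ℝ) ≤ m := m.cast_nonneg
      have hx' : 0 < x := hx
      linarith).continuousAt.continuousWithinAt
  rw [← Set.piecewise_eq_indicator]
  exact h.measurable_piecewise continuousOn_const measurableSet_Ioi

lemma measurable_betaLaw : Measurable fun p : ℝ × ℝ => betaLaw p.1 p.2 := by
  obtain ⟨g, hgm, hg⟩ : ∃ g : ℝ → ℝ, Measurable g ∧ ∀ x, 0 < x → g x = Real.Gamma x :=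
    ⟨_, measurable_gamma_indicator, fun x hx => Set.indicator_of_mem (s := Ioi 0) hx _⟩
  obtain ⟨F, hFm, hF⟩ : ∃ F : (ℝ × ℝ) × ℝ → ℝ≥0∞, Measurable F ∧
      ∀ a b, 0 < a → 0 < b → ∀ x, F ((a, b), x) = betaPDF a b x := by
    refine ⟨fun q => ENNReal.ofReal (if q.2 ∈ Ioo (0 : ℝ) 1 then
      (1 / (g q.1.1 * g q.1.2 / g (q.1.1 + q.1.2))) * q.2 ^ (q.1.1 - 1) *
        (1 - q.2) ^ (q.1.2 - 1) else 0), ?_, ?_⟩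
    · refine ENNReal.measurable_ofReal.comp (Measurable.ite ?_ ?_ measurable_const)
      · exact measurable_snd measurableSet_Ioo
      · have h1 : Measurable fun q : (ℝ × ℝ) × ℝ => g q.1.1 := hgm.comp (by fun_prop)
        have h2 : Measurable fun q : (ℝ × ℝ) × ℝ => g q.1.2 := hgm.comp (by fun_prop)
        have h3 : Measurable fun q : (ℝ × ℝ) × ℝ => g (q.1.1 + q.1.2) := hgm.comp (by fun_prop)
        exact ((measurable_const.div ((h1.mul h2).div h3)).mul
          (Measurable.pow (by fun_prop) (by fun_prop))).mul
          (Measurable.pow (by fun_prop) (by fun_prop))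
    · intro a b ha hb x
      simp only [hg a ha, hg b hb, hg (a + b) (add_pos ha hb)]
      rfl
  have hd : Measurable fun p : ℝ × ℝ => (volume : Measure ℝ).withDensity fun x => F (p, x) := by
    refine Measure.measurable_of_measurable_coe _ fun s hs => ?_
    simp_rw [withDensity_apply _ hs]
    exact hFm.lintegral_prod_right'
  have hS : MeasurableSet {p : ℝ × ℝ | 0 < p.1 ∧ 0 < p.2} :=
    (measurableSet_lt measurable_const measurable_fst).inter
      (measurableSet_lt measurable_const measurable_snd)
  have key : (fun p : ℝ × ℝ => betaLaw p.1 p.2) = fun p =>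
      if 0 < p.1 ∧ 0 < p.2 then
        ((volume : Measure ℝ).withDensity fun x => F (p, x)).map
          (Set.projIcc (0 : ℝ) 1 zero_le_one)
      else if 0 < p.1 then Measure.dirac 1 else Measure.dirac 0 := by
    funext p
    unfold betaLaw
    split_ifs with h h'
    · rw [betaMeasure, funext (hF p.1 p.2 h.1 h.2)]
    · rfl
    · rfl
  rw [key]
  refine Measurable.ite hS ?_ (Measurable.ite ?_ measurable_const measurable_const)
  · exact (Measure.measurable_map _ continuous_projIcc.measurable).comp hd
  · exact measurableSet_lt measurable_const measurable_fst

/-! ### The laws of the Dirichlet process mass and of the HDP mass -/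

/-- The law `Q_α` of `𝕍_α = (V_1, V_2, …)`, where `V_n = (1 - U_1) ⋯ (1 - U_{n-1}) U_n` and
`U_1, U_2, …` are independent with distribution `Beta(1, α)`. -/
def gemLaw (α : ℝ) : Measure simplexInf :=
  (Measure.infinitePi fun _ : ℕ => betaLaw 1 α).map stickBreaking

/-- The conditional law of `(W_1, W_2, …)` given `𝕍_α = v`: the `W_n` are independent, and `W_n`
has distribution `Beta(β v_n, β (1 - ∑_{k ≤ n} v_k))`. -/
def levelTwoMeasure (β : ℝ) (v : simplexInf) : Measure (ℕ → unitInterval) :=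
  Measure.infinitePi fun n : ℕ =>
    betaLaw (β * v.1 n) (β * (1 - ∑ k ∈ Finset.Iic n, v.1 k))

lemma measurable_levelTwoMeasure (β : ℝ) : Measurable (levelTwoMeasure β) := by
  have : ∀ v, IsProbabilityMeasure (levelTwoMeasure β v) := fun v => by
    unfold levelTwoMeasure; infer_instance
  refine Measurable.measure_of_isPiSystem_of_isProbabilityMeasure
    (generateFrom_squareCylinders (α := fun _ : ℕ => unitInterval)).symm
    (isPiSystem_squareCylinders (fun _ => MeasurableSpace.isPiSystem_measurableSet)
      fun _ => MeasurableSet.univ (α := unitInterval)) ?_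
  rintro _ ⟨s, t, ht, rfl⟩
  have hm : ∀ i, MeasurableSet (t i) := fun i => ht i (mem_univ i)
  simp_rw [levelTwoMeasure, Measure.infinitePi_pi _ fun i _ => hm i]
  refine Finset.measurable_prod _ fun i _ => ?_
  have hp : Measurable fun v : simplexInf =>
      (β * v.1 i, β * (1 - ∑ k ∈ Finset.Iic i, v.1 k)) := by
    have hv : ∀ k, Measurable fun v : simplexInf => v.1 k := fun k =>
      (measurable_pi_apply k).comp measurable_subtype_coe
    exact ((hv i).const_mul β).prodMk
      ((measurable_const.sub (Finset.measurable_sum _ fun k _ => hv k)).const_mul β)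
  exact (Measure.measurable_coe (hm i)).comp (measurable_betaLaw.comp hp)

/-- The Markov kernel `v ↦ levelTwoMeasure β v`. -/
def levelTwoKernel (β : ℝ) : Kernel simplexInf (ℕ → unitInterval) :=
  ⟨levelTwoMeasure β, measurable_levelTwoMeasure β⟩

instance (β : ℝ) : IsMarkovKernel (levelTwoKernel β) :=
  ⟨fun v => by
    change IsProbabilityMeasure (levelTwoMeasure β v)
    unfold levelTwoMeasure; infer_instance⟩

/-- The law `Q_{α,β}` of the HDP mass `ℤ_{α,β} = (Z_1, Z_2, …)`, where
`Z_n = (1 - W_1) ⋯ (1 - W_{n-1}) W_n`. -/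
def hdpMassLaw (α β : ℝ) : Measure simplexInf :=
  ((gemLaw α).bind (levelTwoKernel β)).map stickBreaking

instance (α : ℝ) : IsProbabilityMeasure (gemLaw α) :=
  Measure.isProbabilityMeasure_map measurable_stickBreaking.aemeasurable

instance (α β : ℝ) : IsProbabilityMeasure (hdpMassLaw α β) :=
  Measure.isProbabilityMeasure_map measurable_stickBreaking.aemeasurable

/-! ### The rate function -/

/-- The term `x log (x / y)` for `x, y ≥ 0`, with values in `(-∞, ∞]` and the conventions
`0 log (0 / y) = 0` for all `y ≥ 0` and `x log (x / 0) = ∞` for `x > 0`. -/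
def entropyTerm (x y : ℝ) : EReal :=
  if x = 0 then 0 else if y = 0 then ⊤ else ((x * Real.log (x / y) : ℝ) : EReal)

/-- The binary relative entropy
`h(u, w) = u log (u / w) + (1 - u) log ((1 - u) / (1 - w))`. -/
def binEntropy (u w : unitInterval) : EReal :=
  entropyTerm u w + entropyTerm (1 - u) (1 - w)

/-- The coefficient `a`. -/
def coefA (c : ℝ) : ℝ := if c < 1 then c else 1

/-- The coefficient `b`. -/
def coefB (c : ℝ) : ℝ := if 1 < c then c⁻¹ else 1

/-- The quantity minimized in the definition of `I_m`. -/
def cost (c : ℝ) {m : ℕ} (u w : Fin m → unitInterval) : EReal :=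
  ∑ i : Fin m, (((coefA c * Real.log (1 / (1 - (u i : ℝ))) : ℝ) : EReal) +
    ((coefB c * ∏ j ∈ Finset.Iio i, (1 - (u j : ℝ)) : ℝ) : EReal) * binEntropy (u i) (w i))

/-- The function `I_m`. -/
def rateFin (c : ℝ) (m : ℕ) (z : Fin m → ℝ) : EReal :=
  sInf {x | ∃ u w : Fin m → unitInterval, (∀ i, (u i : ℝ) < 1) ∧ stick w = z ∧ x = cost c u w}

/-- The rate function `I(z) = sup_{m ≥ 1} I_m(z_1, …, z_m)`. -/
def rate (c : ℝ) (z : simplexInf) : EReal :=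
  ⨆ m : ℕ, ⨆ _ : 1 ≤ m, rateFin c m fun i : Fin m => z.1 i

end HDP

end

noncomputable section

namespace HDP

/-! ### Large deviation principles from local bounds -/

/-! The space `simplexInf` is compact, so it suffices to prove two local statements
(`satisfiesLDP_of_local`): near a point `z`, some neighbourhood has mass at most `C exp (-γ M)` for
each `M < I(z)`, and every neighbourhood has mass at least `C exp (-γ M)` for each `M > I(z)`.
Compactness of the sublevel sets and nonnegativity of the rate function also follow from this pair
of bounds.

All randomness comes from Beta variables of one shape, `Beta(σ t, σ (1 - t))` with mean `t` and
large `σ`. Given the first level, `W_k` has this form with `t = U_k` and `σ = β ∏_{j<k} (1 - U_j)`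
(`levelTwoMeasure_stickBreaking`); the law `Beta(1, α)` has it with `σ = 1 + α` and `t = 1 / (1 +
α)`, a mean tending to `0`. Such a variable deviates to `w` with exponential cost `σ h(t, w)`. The
upper bound `betaLaw_le` is exact, without prefactor; the lower bound `le_betaLaw` loses only a
factor of order `t (1 - t)`. Both are needed uniformly for parameters near their limits, because the
parameters of the second level depend on the random first level.

Multiplying these bounds over small boxes gives the local rate of the first `m` pairs `(U_k, W_k)`:
the first level contributes `a h(0, u_k) = a log (1 / (1 - u_k))`, the second `b ∏_{j<k} (1 - u_j)
h(u_k, w_k)` (`jointFin_upperDecay`, `jointFin_lowerDecay`). The continuous map `stick` pushes this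
to `(z_1, …, z_m)` as in the contraction principle, which produces the infimum in `I_m`. Since
neighbourhoods in the product topology constrain finitely many coordinates, the supremum over `m` is
the rate on the whole space. -/

/-- `P i N` decays at least like `exp (-a i * M)` along `l`, up to a constant. -/
def UpperDecay {ι S : Type*} [MeasurableSpace S] (l : Filter ι) (P : ι → Measure S) (a : ι → ℝ)
    (N : Set S) (M : ℝ) : Prop :=
  ∃ C : ℝ, 0 < C ∧ ∀ᶠ i in l, P i N ≤ ENNReal.ofReal (C * Real.exp (-(a i * M)))

/-- `P i N` decays at most like `exp (-a i * M)` along `l`, up to a constant. -/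
def LowerDecay {ι S : Type*} [MeasurableSpace S] (l : Filter ι) (P : ι → Measure S) (a : ι → ℝ)
    (N : Set S) (M : ℝ) : Prop :=
  ∃ C : ℝ, 0 < C ∧ ∀ᶠ i in l, ENNReal.ofReal (C * Real.exp (-(a i * M))) ≤ P i N

section Decay

variable {ι S : Type*} [MeasurableSpace S] {l : Filter ι} {P : ι → Measure S} {a : ι → ℝ}

lemma UpperDecay.mono {N N' : Set S} {M : ℝ} (h : UpperDecay l P a N M) (hN : N' ⊆ N) :
    UpperDecay l P a N' M := by
  obtain ⟨C, hC, h⟩ := h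
  exact ⟨C, hC, h.mono fun i hi => (measure_mono hN).trans hi⟩

lemma LowerDecay.mono {N N' : Set S} {M : ℝ} (h : LowerDecay l P a N M) (hN : N ⊆ N') :
    LowerDecay l P a N' M := by
  obtain ⟨C, hC, h⟩ := h
  exact ⟨C, hC, h.mono fun i hi => hi.trans (measure_mono hN)⟩

lemma UpperDecay.biUnion {κ : Type*} (t : Finset κ) {N : κ → Set S} {M : ℝ}
    (h : ∀ k ∈ t, UpperDecay l P a (N k) M) : UpperDecay l P a (⋃ k ∈ t, N k) M := by
  classical
  induction t using Finset.induction_on with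
  | empty => exact ⟨1, one_pos, Eventually.of_forall fun i => by simp⟩
  | insert k t hk ih =>
    obtain ⟨C, hC, h1⟩ := h k (Finset.mem_insert_self k t)
    obtain ⟨D, hD, h2⟩ := ih fun j hj => h j (Finset.mem_insert_of_mem hj)
    refine ⟨C + D, by positivity, ?_⟩
    filter_upwards [h1, h2] with i hi1 hi2
    rw [Finset.set_biUnion_insert, add_mul, ENNReal.ofReal_add (by positivity) (by positivity)]
    exact (measure_union_le _ _).trans (add_le_add hi1 hi2)

/-- Any loss in the exponent beats every constant factor, so the constants in `UpperDecay` and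
`LowerDecay` do not affect the rate. -/
lemma eventually_const_mul_exp_lt (ha : Tendsto a l atTop) {C D : ℝ} (hD : 0 < D)
    {M M' : ℝ} (hM : M' < M) :
    ∀ᶠ i in l, C * Real.exp (-(a i * M)) < D * Real.exp (-(a i * M')) := by
  have h1 : Tendsto (fun i => C * Real.exp (-(a i * (M - M')))) l (𝓝 (C * 0)) :=
    (Real.tendsto_exp_neg_atTop_nhds_zero.comp
      (ha.atTop_mul_const (sub_pos.2 hM))).const_mul C
  rw [mul_zero] at h1
  filter_upwards [h1.eventually (gt_mem_nhds hD)] with i hi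
  have : Real.exp (-(a i * M)) = Real.exp (-(a i * (M - M'))) * Real.exp (-(a i * M')) := by
    rw [← Real.exp_add]; ring_nf
  rw [this, ← mul_assoc]
  exact mul_lt_mul_of_pos_right hi (Real.exp_pos _)

/-- This comparison makes the local bounds determine the rate: it yields both its nonnegativity and
its lower semicontinuity. -/
lemma UpperDecay.le_of_lowerDecay [l.NeBot] (ha : Tendsto a l atTop) {N : Set S} {M M' : ℝ}
    (h : UpperDecay l P a N M) (h' : LowerDecay l P a N M') : M ≤ M' := by
  by_contra! hlt
  obtain ⟨C, hC, h1⟩ := h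
  obtain ⟨D, hD, h2⟩ := h'
  obtain ⟨i, hi1, hi2, hi3⟩ := (h1.and (h2.and (eventually_const_mul_exp_lt ha hD hlt))).exists
  exact absurd (hi2.trans hi1) (not_le.2 (ENNReal.ofReal_lt_ofReal_iff (by positivity) |>.2 hi3))

lemma UpperDecay.limsup_le (ha : Tendsto a l atTop) {N : Set S} {M : ℝ}
    (h : UpperDecay l P a N M) :
    limsup (fun i => (((a i)⁻¹ : ℝ) : EReal) * ENNReal.log (P i N)) l ≤ ((-M : ℝ) : EReal) := by
  obtain ⟨C, hC, h⟩ := h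
  refine EReal.le_of_forall_lt_iff_le.1 fun r hr => ?_
  have hr' : -r < M := by
    have := EReal.coe_lt_coe_iff.1 hr
    linarith
  refine limsup_le_of_le (by isBoundedDefault) ?_
  filter_upwards [h, eventually_const_mul_exp_lt ha (C := C) one_pos hr',
    ha.eventually_gt_atTop 0] with i hi1 hi2 hi3
  have h3 : ENNReal.log (P i N) ≤ ((a i * r : ℝ) : EReal) := by
    refine (ENNReal.log_le_log (hi1.trans (ENNReal.ofReal_le_ofReal hi2.le))).trans ?_
    rw [ENNReal.log_ofReal_of_pos (by positivity), one_mul, Real.log_exp]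
    simp
  refine (mul_le_mul_of_nonneg_left h3 (by exact_mod_cast (inv_pos.2 hi3).le)).trans ?_
  rw [← EReal.coe_mul, ← mul_assoc, inv_mul_cancel₀ hi3.ne', one_mul]

lemma LowerDecay.le_liminf (ha : Tendsto a l atTop) {N : Set S} {M : ℝ}
    (h : LowerDecay l P a N M) :
    ((-M : ℝ) : EReal) ≤ liminf (fun i => (((a i)⁻¹ : ℝ) : EReal) * ENNReal.log (P i N)) l := by
  obtain ⟨C, hC, h⟩ := h
  refine EReal.ge_of_forall_gt_iff_ge.1 fun r hr => ?_
  have hr' : M < -r := by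
    have := EReal.coe_lt_coe_iff.1 hr
    linarith
  refine le_liminf_of_le (by isBoundedDefault) ?_
  filter_upwards [h, eventually_const_mul_exp_lt ha (C := 1) hC hr',
    ha.eventually_gt_atTop 0] with i hi1 hi2 hi3
  have h3 : ((a i * r : ℝ) : EReal) ≤ ENNReal.log (P i N) := by
    refine le_trans ?_ (ENNReal.log_le_log ((ENNReal.ofReal_le_ofReal hi2.le).trans hi1))
    rw [ENNReal.log_ofReal_of_pos (by positivity), one_mul, Real.log_exp]
    simp
  refine le_trans ?_ (mul_le_mul_of_nonneg_left h3 (by exact_mod_cast (inv_pos.2 hi3).le))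
  rw [← EReal.coe_mul, ← mul_assoc, inv_mul_cancel₀ hi3.ne', one_mul]

end Decay

/-- On a compact space, local upper and lower exponential bounds imply a large deviation
principle with good rate function. -/
theorem satisfiesLDP_of_local {ι S : Type*} [TopologicalSpace S] [CompactSpace S]
    [MeasurableSpace S] {l : Filter ι} [l.NeBot] {P : ι → Measure S}
    [∀ i, IsProbabilityMeasure (P i)] {a : ι → ℝ} {I : S → EReal} (ha : Tendsto a l atTop)
    (hU : ∀ s, ∀ M : ℝ, (M : EReal) < I s → ∃ N ∈ 𝓝 s, UpperDecay l P a N M)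
    (hL : ∀ s, ∀ M : ℝ, I s < M → ∀ N ∈ 𝓝 s, LowerDecay l P a N M) :
    SatisfiesLDP l P a I where
  speed_tendsto := ha
  rate_nonneg s := by
    refine EReal.ge_of_forall_gt_iff_ge.1 fun r hr => ?_
    by_contra! hlt
    have hr0 : r < 0 := by exact_mod_cast hr
    have h1 : UpperDecay l P a univ 0 :=
      ⟨1, one_pos, Eventually.of_forall fun i => by simp⟩
    exact absurd (h1.le_of_lowerDecay ha (hL s r hlt univ univ_mem)) (not_le.2 hr0)
  isCompact_sublevel r _ := by
    refine IsClosed.isCompact (isOpen_compl_iff.1 (isOpen_iff_mem_nhds.2 fun s hs => ?_))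
    simp only [mem_compl_iff, mem_ofPred_eq, not_le] at hs
    obtain ⟨M, hrM, hMI⟩ := EReal.lt_iff_exists_real_btwn.1 hs
    obtain ⟨M', hrM', hM'M⟩ := exists_between (EReal.coe_lt_coe_iff.1 hrM)
    obtain ⟨N, hN, hdec⟩ := hU s M hMI
    -- The set `N` is a neighbourhood of every `s'` close to `s`. If `I s' ≤ r`, its mass would
    -- decay no faster than rate `M' < M`, against its upper bound.
    refine mem_of_superset (eventually_mem_nhds_iff.2 hN) fun s' hs' hle => ?_
    refine absurd (hdec.le_of_lowerDecay ha (hL s' M' (lt_of_le_of_lt hle ?_) N hs')) (not_le.2 hM'M)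
    exact_mod_cast hrM'
  lower_bound G _ := by
    rw [EReal.neg_le]
    refine le_iInf₂ fun s hs => ?_
    rw [EReal.neg_le]
    refine EReal.ge_of_forall_gt_iff_ge.1 fun r hr => ?_
    have hr' : I s < ((-r : ℝ) : EReal) := by
      rw [EReal.coe_neg]; exact EReal.lt_neg_comm.1 hr
    simpa using (hL s (-r) hr' G (mem_interior_iff_mem_nhds.1 hs)).le_liminf ha
  liminf_le_limsup G _ := liminf_le_limsup
  upper_bound G _ := by
    rw [EReal.le_neg]
    refine EReal.ge_of_forall_gt_iff_ge.1 fun M hM => ?_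
    have h1 : ∀ s ∈ closure G, ∃ N ∈ 𝓝 s, UpperDecay l P a N M := fun s hs =>
      hU s M (hM.trans_le (iInf₂_le s hs))
    choose! N hN hdec using h1
    obtain ⟨t, ht, htG⟩ := isClosed_closure.isCompact.elim_nhds_subcover N hN
    have h2 : UpperDecay l P a G M :=
      (UpperDecay.biUnion t fun s hs => hdec s (ht s hs)).mono (subset_closure.trans htG)
    rw [EReal.le_neg]
    simpa using h2.limsup_le ha

/-! ### Binary relative entropy -/

/-- The binary relative entropy as a real-valued function, meaningful for `0 < w < 1`. -/
def klReal (t w : ℝ) : ℝ := -Real.binEntropy t - t * Real.log w - (1 - t) * Real.log (1 - w)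

lemma klReal_eq_log_div {t w : ℝ} (ht : 0 < t) (ht1 : t < 1) (hw : 0 < w) (hw1 : w < 1) :
    klReal t w = t * Real.log (t / w) + (1 - t) * Real.log ((1 - t) / (1 - w)) := by
  rw [klReal, Real.binEntropy, Real.log_div ht.ne' hw.ne',
    Real.log_div (by linarith) (by linarith), Real.log_inv, Real.log_inv]
  ring

lemma klReal_self (t : ℝ) : klReal t t = 0 := by
  rw [klReal, Real.binEntropy, Real.log_inv, Real.log_inv]
  ring

lemma klReal_one_sub (t w : ℝ) : klReal (1 - t) (1 - w) = klReal t w := by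
  simp only [klReal, Real.binEntropy_one_sub, sub_sub_cancel]
  ring

lemma klReal_zero_left (w : ℝ) : klReal 0 w = -Real.log (1 - w) := by
  simp [klReal]

lemma klReal_nonneg {t w : ℝ} (ht : 0 < t) (ht1 : t < 1) (hw : 0 < w) (hw1 : w < 1) :
    0 ≤ klReal t w := by
  have h1 := Real.log_le_sub_one_of_pos (div_pos hw ht)
  have h2 := Real.log_le_sub_one_of_pos (div_pos (sub_pos.2 hw1) (sub_pos.2 ht1))
  have h3 := mul_le_mul_of_nonneg_left h1 ht.le
  have h4 := mul_le_mul_of_nonneg_left h2 (sub_pos.2 ht1).le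
  rw [mul_sub, mul_div_cancel₀ _ ht.ne', Real.log_div hw.ne' ht.ne'] at h3
  rw [mul_sub, mul_div_cancel₀ _ (sub_pos.2 ht1).ne',
    Real.log_div (sub_pos.2 hw1).ne' (sub_pos.2 ht1).ne'] at h4
  rw [klReal, Real.binEntropy, Real.log_inv, Real.log_inv]
  linarith

/-- Only the second argument must stay inside `(0, 1)`. Continuity at `t = 0` and `t = 1` is what
later allows means that tend to `0`. -/
lemma continuousAt_klReal {X : Type*} [TopologicalSpace X] {f g : X → ℝ} {x : X}
    (hf : ContinuousAt f x) (hg : ContinuousAt g x) (h0 : 0 < g x) (h1 : g x < 1) :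
    ContinuousAt (fun y => klReal (f y) (g y)) x := by
  have e1 : ContinuousAt (fun y => Real.log (g y)) x := hg.log h0.ne'
  have e2 : ContinuousAt (fun y => Real.log (1 - g y)) x :=
    (continuousAt_const.sub hg).log (sub_pos.2 h1).ne'
  have e3 : ContinuousAt (fun y => Real.binEntropy (f y)) x :=
    Real.binEntropy_continuous.continuousAt.comp hf
  unfold klReal
  fun_prop

lemma rpow_mul_one_sub_rpow {x : ℝ} (hx : 0 < x) (hx1 : x < 1) (σ t : ℝ) :
    x ^ (σ * t) * (1 - x) ^ (σ * (1 - t)) =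
      Real.exp (-(σ * klReal t x)) * Real.exp (-(σ * Real.binEntropy t)) := by
  rw [Real.rpow_def_of_pos hx, Real.rpow_def_of_pos (sub_pos.2 hx1), ← Real.exp_add,
    ← Real.exp_add, klReal]
  ring_nf

lemma entropyTerm_ne_bot (x y : ℝ) : entropyTerm x y ≠ ⊥ := by
  unfold entropyTerm
  split_ifs
  · simp
  · simp
  · exact EReal.coe_ne_bot _

lemma binEntropy_ne_bot (u w : unitInterval) : binEntropy u w ≠ ⊥ := by
  unfold binEntropy
  rw [EReal.add_ne_bot_iff]
  exact ⟨entropyTerm_ne_bot _ _, entropyTerm_ne_bot _ _⟩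

lemma entropyTerm_eq_coe {x y : ℝ} (h : y = 0 → x = 0) :
    entropyTerm x y = ((x * Real.log x - x * Real.log y : ℝ) : EReal) := by
  unfold entropyTerm
  split_ifs with hx hy
  · simp [hx]
  · exact absurd (h hy) hx
  · rw [Real.log_div hx hy, mul_sub]

lemma binEntropy_eq_coe {u w : unitInterval} (h0 : (w : ℝ) = 0 → (u : ℝ) = 0)
    (h1 : (w : ℝ) = 1 → (u : ℝ) = 1) : binEntropy u w = (klReal u w : EReal) := by
  unfold binEntropy
  rw [entropyTerm_eq_coe h0, entropyTerm_eq_coe (fun h => by linarith [h1 (by linarith)]),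
    ← EReal.coe_add, klReal, Real.binEntropy, Real.log_inv, Real.log_inv]
  congr 1
  ring

lemma binEntropy_eq_top_of_eq_zero {u w : unitInterval} (hw : (w : ℝ) = 0) (hu : (u : ℝ) ≠ 0) :
    binEntropy u w = ⊤ := by
  unfold binEntropy
  rw [entropyTerm, if_neg hu, if_pos hw, EReal.top_add_of_ne_bot (entropyTerm_ne_bot _ _)]

lemma binEntropy_eq_top_of_eq_one {u w : unitInterval} (hw : (w : ℝ) = 1) (hu : (u : ℝ) ≠ 1) :
    binEntropy u w = ⊤ := by
  unfold binEntropy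
  have h : entropyTerm (1 - (u : ℝ)) (1 - (w : ℝ)) = ⊤ := by
    rw [entropyTerm, if_neg (by intro h; apply hu; linarith), if_pos (by rw [hw, sub_self])]
  rw [h, EReal.add_top_of_ne_bot (entropyTerm_ne_bot _ _)]

lemma eq_of_binEntropy_ne_top {u w : unitInterval} (h : binEntropy u w ≠ ⊤) :
    ((w : ℝ) = 0 → (u : ℝ) = 0) ∧ ((w : ℝ) = 1 → (u : ℝ) = 1) :=
  ⟨fun hw => by_contra fun hu => h (binEntropy_eq_top_of_eq_zero hw hu),
    fun hw => by_contra fun hu => h (binEntropy_eq_top_of_eq_one hw hu)⟩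

lemma binEntropy_self (u : unitInterval) : binEntropy u u = 0 := by
  rw [binEntropy_eq_coe id id, klReal_self, EReal.coe_zero]

lemma binEntropy_symm (u w : unitInterval) :
    binEntropy (unitInterval.symm u) (unitInterval.symm w) = binEntropy u w := by
  unfold binEntropy
  simp only [unitInterval.coe_symm_eq, sub_sub_cancel]
  exact add_comm _ _

/-! ### Exponential bounds for Beta distributions -/

/-- The substitution `y = A x / D`, with `D = A x + B (1 - x)`, maps `(0, 1)` injectively into
itself and turns the Beta density at `y` into `A ^ p * B ^ q / D ^ (p + q)` times the density at
`x`. Where `D ≤ 1` this factor is at least `A ^ p * B ^ q`, and the image of `S` has mass at most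
one. It is an exponential change of measure in Beta form. -/
lemma betaMeasure_le {p q A B : ℝ} (hp : 0 < p) (hq : 0 < q) (hA : 0 < A) (hB : 0 < B)
    {S : Set ℝ} (hS : MeasurableSet S)
    (h : ∀ x ∈ S, 0 < x → x < 1 → A * x + B * (1 - x) ≤ 1) :
    betaMeasure p q S ≤ ENNReal.ofReal (A ^ p * B ^ q)⁻¹ := by
  have hT : MeasurableSet (S ∩ Ioo 0 1) := hS.inter measurableSet_Ioo
  have hpos : 0 < A ^ p * B ^ q := mul_pos (Real.rpow_pos_of_pos hA p) (Real.rpow_pos_of_pos hB q)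
  have hST : betaMeasure p q S = ∫⁻ x in S ∩ Ioo 0 1, betaPDF p q x := by
    rw [betaMeasure, withDensity_apply _ hS, ← lintegral_inter_add_sdiff _ _ measurableSet_Ioo,
      setLIntegral_eq_zero (hS.diff measurableSet_Ioo), add_zero]
    rintro x ⟨-, hx⟩
    rw [betaPDF_eq, if_neg (by simpa [Ioo] using hx)]
    simp
  have hD : ∀ x ∈ S ∩ Ioo (0 : ℝ) 1, 0 < A * x + B * (1 - x) := fun x hx =>
    add_pos (mul_pos hA hx.2.1) (mul_pos hB (sub_pos.2 hx.2.2))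
  have hderiv : ∀ x ∈ S ∩ Ioo (0 : ℝ) 1,
      HasDerivWithinAt (fun x => A * x / (A * x + B * (1 - x)))
        (A * B / (A * x + B * (1 - x)) ^ 2) (S ∩ Ioo 0 1) x := fun x hx => by
    have h1 : HasDerivAt (fun x : ℝ => A * x) A x := by simpa using (hasDerivAt_id x).const_mul A
    have h2 : HasDerivAt (fun x : ℝ => A * x + B * (1 - x)) (A + B * (-1)) x := by
      simpa using h1.fun_add (((hasDerivAt_id x).const_sub 1).const_mul B)
    refine (h1.fun_div h2 (hD x hx).ne').hasDerivWithinAt.congr_deriv ?_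
    congr 1
    ring
  have hinj : InjOn (fun x => A * x / (A * x + B * (1 - x))) (S ∩ Ioo 0 1) := by
    intro x hx y hy hxy
    simp only [div_eq_div_iff (hD x hx).ne' (hD y hy).ne'] at hxy
    have : A * B * (x - y) = 0 := by linarith
    have h0 := (mul_eq_zero.1 this).resolve_left (mul_pos hA hB).ne'
    linarith
  have hpt : ∀ x ∈ S ∩ Ioo (0 : ℝ) 1, ENNReal.ofReal (A ^ p * B ^ q) * betaPDF p q x ≤
      ENNReal.ofReal |A * B / (A * x + B * (1 - x)) ^ 2| *
        betaPDF p q (A * x / (A * x + B * (1 - x))) := by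
    intro x hx
    have hx0 := hx.2.1
    have hx1 := sub_pos.2 hx.2.2
    have hDx := hD x hx
    have hD1 := h x hx.1 hx.2.1 hx.2.2
    set D := A * x + B * (1 - x) with hDdef
    have hy : 1 - A * x / D = B * (1 - x) / D := by
      rw [eq_div_iff hDx.ne', sub_mul, div_mul_cancel₀ _ hDx.ne']
      rw [hDdef]; ring
    have hBx : 0 < B * (1 - x) := mul_pos hB hx1
    have hAx : 0 < A * x := mul_pos hA hx0
    have hy1 : A * x / D < 1 := by
      have : 0 < B * (1 - x) / D := div_pos hBx hDx
      linarith
    rw [betaPDF_of_pos_lt_one hx0 hx.2.2, betaPDF_of_pos_lt_one (div_pos hAx hDx) hy1,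
      ← ENNReal.ofReal_mul hpos.le, ← ENNReal.ofReal_mul (abs_nonneg _)]
    refine ENNReal.ofReal_le_ofReal ?_
    rw [hy, abs_of_pos (by positivity), Real.div_rpow hAx.le hDx.le, Real.div_rpow hBx.le hDx.le,
      Real.mul_rpow hA.le hx0.le, Real.mul_rpow hB.le hx1.le]
    have eA : A ^ p = A * A ^ (p - 1) := by
      rw [← Real.rpow_one_add' hA.le (by linarith), add_sub_cancel]
    have eB : B ^ q = B * B ^ (q - 1) := by
      rw [← Real.rpow_one_add' hB.le (by linarith), add_sub_cancel]
    have eD : D ^ (p + q) = D ^ 2 * (D ^ (p - 1) * D ^ (q - 1)) := by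
      rw [← Real.rpow_natCast, ← Real.rpow_add hDx, ← Real.rpow_add hDx]
      congr 1
      push_cast
      ring
    have hD2 : D ^ (p + q) ≤ 1 := Real.rpow_le_one hDx.le hD1 (by linarith)
    have hDp : 0 < D ^ (p + q) := Real.rpow_pos_of_pos hDx _
    have key : A * B / D ^ 2 * (1 / beta p q * (A ^ (p - 1) * x ^ (p - 1) / D ^ (p - 1)) *
        (B ^ (q - 1) * (1 - x) ^ (q - 1) / D ^ (q - 1))) =
        A ^ p * B ^ q * (1 / beta p q * x ^ (p - 1) * (1 - x) ^ (q - 1)) / D ^ (p + q) := by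
      rw [eA, eB, eD]
      field_simp
    rw [key, le_div_iff₀ hDp]
    have := beta_pos hp hq
    exact mul_le_of_le_one_right (by positivity) hD2
  have hmain : ENNReal.ofReal (A ^ p * B ^ q) * betaMeasure p q S ≤ 1 := by
    rw [hST, ← lintegral_const_mul' _ _ ENNReal.ofReal_ne_top]
    calc _ ≤ ∫⁻ x in S ∩ Ioo 0 1, ENNReal.ofReal |A * B / (A * x + B * (1 - x)) ^ 2| *
          betaPDF p q (A * x / (A * x + B * (1 - x))) := setLIntegral_mono' hT hpt
      _ = ∫⁻ y in (fun x => A * x / (A * x + B * (1 - x))) '' (S ∩ Ioo 0 1), betaPDF p q y :=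
        (lintegral_image_eq_lintegral_abs_deriv_mul hT hderiv hinj _).symm
      _ ≤ ∫⁻ y, betaPDF p q y := setLIntegral_le_lintegral _ _
      _ = 1 := lintegral_betaPDF_eq_one hp hq
  rw [ENNReal.ofReal_inv_of_pos hpos]
  exact ENNReal.le_inv_iff_mul_le.2 (by rwa [mul_comm])

/-- The hypothesis says that `w` separates `t` from `S`. Take `A = t / w` and `B = (1 - t) / (1 -
w)` in `betaMeasure_le`: the affine function `A x + B (1 - x)` equals `1` at `x = w`, is at most `1`
on the side of `w` away from `t`, and `A ^ p * B ^ q` is `exp (σ * klReal t w)`. For `t = 0` or `t =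
1` the law is a point mass outside `S`. -/
lemma betaLaw_le {σ t w : ℝ} (hσ : 0 < σ) (ht : t ∈ Icc (0 : ℝ) 1) (hw : 0 < w) (hw1 : w < 1)
    {S : Set unitInterval} (hS : MeasurableSet S) (h : ∀ x ∈ S, (w - t) * (w - x) ≤ 0) :
    betaLaw (σ * t) (σ * (1 - t)) S ≤ ENNReal.ofReal (Real.exp (-(σ * klReal t w))) := by
  rcases ht.1.eq_or_lt with rfl | ht0
  · have : (0 : unitInterval) ∉ S := fun h0 => by
      have := h 0 h0
      simp only [Icc.coe_zero] at this
      nlinarith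
    simp [betaLaw, Measure.dirac_apply' _ hS, this]
  rcases ht.2.eq_or_lt with rfl | ht1
  · have : (1 : unitInterval) ∉ S := fun h0 => by
      have := h 1 h0
      simp only [Icc.coe_one] at this
      nlinarith
    simp [betaLaw, hσ, Measure.dirac_apply' _ hS, this]
  have h1 : 0 < 1 - t := sub_pos.2 ht1
  have h1w : 0 < 1 - w := sub_pos.2 hw1
  have hp : 0 < σ * t := mul_pos hσ ht0
  have hq : 0 < σ * (1 - t) := mul_pos hσ h1
  rw [betaLaw, if_pos ⟨hp, hq⟩, Measure.map_apply continuous_projIcc.measurable hS]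
  refine (betaMeasure_le hp hq (div_pos ht0 hw) (div_pos h1 h1w)
    (continuous_projIcc.measurable hS) fun x hx hx0 hx1 => ?_).trans_eq ?_
  · have := h _ hx
    rw [projIcc_of_mem zero_le_one ⟨hx0.le, hx1.le⟩] at this
    rw [div_mul_eq_mul_div, div_mul_eq_mul_div, div_add_div _ _ hw.ne' h1w.ne',
      div_le_one (mul_pos hw h1w)]
    nlinarith
  · rw [Real.rpow_def_of_pos (div_pos ht0 hw), Real.rpow_def_of_pos (div_pos h1 h1w),
      ← Real.exp_add, ← Real.exp_neg, klReal_eq_log_div ht0 ht1 hw hw1]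
    congr 2
    ring

lemma beta_add_one_add_one {p q : ℝ} (hp : 0 < p) (hq : 0 < q) :
    beta (p + 1) (q + 1) = beta p q * (p * q / ((p + q) * (p + q + 1))) := by
  have h1 : Real.Gamma (p + 1 + (q + 1)) = (p + q + 1) * ((p + q) * Real.Gamma (p + q)) := by
    rw [← Real.Gamma_add_one (by positivity), ← Real.Gamma_add_one (by positivity)]
    congr 1; ring
  have h2 := (Real.Gamma_pos_of_pos (add_pos hp hq)).ne'
  have h3 : p + q ≠ 0 := by positivity
  have h4 : p + q + 1 ≠ 0 := by positivity
  rw [beta, beta, h1, Real.Gamma_add_one hp.ne', Real.Gamma_add_one hq.ne']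
  field_simp

/-- The integrand `x ^ (σ t) * (1 - x) ^ (σ (1 - t))` of this Beta integral is largest at `x = t`,
where it equals the right-hand side. -/
lemma beta_add_one_le {σ t : ℝ} (hσ : 0 < σ) (ht : 0 < t) (ht1 : t < 1) :
    beta (σ * t + 1) (σ * (1 - t) + 1) ≤ Real.exp (-(σ * Real.binEntropy t)) := by
  have hp : 0 < σ * t := mul_pos hσ ht
  have hq : 0 < σ * (1 - t) := mul_pos hσ (sub_pos.2 ht1)
  have hb : 0 < beta (σ * t + 1) (σ * (1 - t) + 1) := beta_pos (by linarith) (by linarith)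
  have h1 := lintegral_betaPDF_eq_one (α := σ * t + 1) (β := σ * (1 - t) + 1)
    (by linarith) (by linarith)
  rw [lintegral_betaPDF] at h1
  have h2 : ∫⁻ (x : ℝ) in Ioo 0 1, ENNReal.ofReal (1 / beta (σ * t + 1) (σ * (1 - t) + 1) *
      x ^ (σ * t + 1 - 1) * (1 - x) ^ (σ * (1 - t) + 1 - 1)) ≤
      ∫⁻ (_ : ℝ) in Ioo 0 1, ENNReal.ofReal (1 / beta (σ * t + 1) (σ * (1 - t) + 1) *
        Real.exp (-(σ * Real.binEntropy t))) := by
    refine setLIntegral_mono' measurableSet_Ioo fun x hx => ENNReal.ofReal_le_ofReal ?_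
    rw [add_sub_cancel_right, add_sub_cancel_right, mul_assoc, rpow_mul_one_sub_rpow hx.1 hx.2]
    refine mul_le_mul_of_nonneg_left ?_ (by positivity)
    refine mul_le_of_le_one_left (Real.exp_pos _).le (Real.exp_le_one_iff.2 ?_)
    have := mul_nonneg hσ.le (klReal_nonneg ht ht1 hx.1 hx.2)
    linarith
  rw [h1, setLIntegral_const, Real.volume_Ioo, sub_zero, ENNReal.ofReal_one, mul_one,
    ENNReal.one_le_ofReal, one_div, inv_mul_eq_div, one_le_div hb] at h2
  exact h2

/-- Since `x` and `1 - x` are at most `1`, raising both exponents of the density by one only lowers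
it. The density then becomes `exp (-σ klReal t x)` up to normalisation, and the change of
normalising constant costs the explicit factor `σ t (1 - t) / (σ + 1)`. -/
lemma le_betaLaw {σ t a b K : ℝ} (hσ : 0 < σ) (ht : 0 < t) (ht1 : t < 1) (ha : 0 < a)
    (hb : b < 1) {S : Set unitInterval} (hS : MeasurableSet S)
    (hab : ∀ x : unitInterval, (x : ℝ) ∈ Ioo a b → x ∈ S) (hK : ∀ x ∈ Ioo a b, klReal t x ≤ K) :
    ENNReal.ofReal ((b - a) * (σ * (t * (1 - t)) / (σ + 1)) * Real.exp (-(σ * K))) ≤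
      betaLaw (σ * t) (σ * (1 - t)) S := by
  have h1 : 0 < 1 - t := sub_pos.2 ht1
  have hp : 0 < σ * t := mul_pos hσ ht
  have hq : 0 < σ * (1 - t) := mul_pos hσ h1
  have hB := beta_pos hp hq
  have hc : 0 < σ * (t * (1 - t)) / (σ + 1) := by positivity
  have hbeta : beta (σ * t) (σ * (1 - t)) * (σ * (t * (1 - t)) / (σ + 1)) ≤
      Real.exp (-(σ * Real.binEntropy t)) := by
    refine le_trans (le_of_eq ?_) (beta_add_one_le hσ ht ht1)
    rw [beta_add_one_add_one hp hq]
    congr 1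
    have : σ * t + σ * (1 - t) = σ := by ring
    rw [this]
    field_simp
  rw [betaLaw, if_pos ⟨hp, hq⟩, Measure.map_apply continuous_projIcc.measurable hS]
  have hsub : Ioo a b ⊆ projIcc (0 : ℝ) 1 zero_le_one ⁻¹' S := fun x hx => by
    rw [mem_preimage, projIcc_of_mem zero_le_one ⟨(ha.trans hx.1).le, (hx.2.trans hb).le⟩]
    exact hab _ hx
  refine le_trans ?_ (measure_mono hsub)
  rw [betaMeasure, withDensity_apply _ measurableSet_Ioo]
  calc _ = ∫⁻ _ in Ioo a b,
        ENNReal.ofReal (σ * (t * (1 - t)) / (σ + 1) * Real.exp (-(σ * K))) := by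
        rw [setLIntegral_const, Real.volume_Ioo, ← ENNReal.ofReal_mul (by positivity)]
        congr 1
        ring
    _ ≤ _ := by
        refine setLIntegral_mono' measurableSet_Ioo fun x hx => ?_
        have hx0 : 0 < x := ha.trans hx.1
        have hx1 : x < 1 := hx.2.trans hb
        have h1x : 0 < 1 - x := sub_pos.2 hx1
        rw [betaPDF_of_pos_lt_one hx0 hx1]
        refine ENNReal.ofReal_le_ofReal ?_
        have e1 : x ^ (σ * t) ≤ x ^ (σ * t - 1) :=
          Real.rpow_le_rpow_of_exponent_ge hx0 hx1.le (by linarith)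
        have e2 : (1 - x) ^ (σ * (1 - t)) ≤ (1 - x) ^ (σ * (1 - t) - 1) :=
          Real.rpow_le_rpow_of_exponent_ge h1x (by linarith) (by linarith)
        have e3 : x ^ (σ * t) * (1 - x) ^ (σ * (1 - t)) ≤
            x ^ (σ * t - 1) * (1 - x) ^ (σ * (1 - t) - 1) :=
          mul_le_mul e1 e2 (Real.rpow_nonneg h1x.le _) (Real.rpow_nonneg hx0.le _)
        rw [rpow_mul_one_sub_rpow hx0 hx1] at e3
        have e4 : Real.exp (-(σ * K)) ≤ Real.exp (-(σ * klReal t x)) :=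
          Real.exp_le_exp.2 (neg_le_neg (mul_le_mul_of_nonneg_left (hK x hx) hσ.le))
        rw [mul_assoc, one_div, inv_mul_eq_div, le_div_iff₀ hB]
        refine le_trans ?_ e3
        calc _ = Real.exp (-(σ * K)) *
              (beta (σ * t) (σ * (1 - t)) * (σ * (t * (1 - t)) / (σ + 1))) := by ring
          _ ≤ _ := mul_le_mul e4 hbeta (by positivity) (Real.exp_pos _).le

/-! ### Locally uniform exponential bounds for Beta distributions -/

/-- For `w < 1` this is continuity. For `w = 1` the entropy is infinite, and `klReal u x` tends to
infinity as `x` increases to `1` because of the term `-(1 - u) log (1 - x)`. -/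
lemma eventually_lt_mul_klReal {ρ : ℝ} (hρ : 0 < ρ) {u w : unitInterval} {M : ℝ}
    (hM : (M : EReal) < (ρ : EReal) * binEntropy u w) (huw : u < w) :
    ∀ᶠ x in 𝓝[<] (w : ℝ), M < ρ * klReal u x := by
  have hw0 : (0 : ℝ) < w := u.2.1.trans_lt huw
  rcases w.2.2.lt_or_eq with hw1 | hw1
  · rw [binEntropy_eq_coe (fun h => absurd h hw0.ne') (fun h => absurd h hw1.ne),
      ← EReal.coe_mul, EReal.coe_lt_coe_iff] at hM
    have hc : ContinuousAt (fun x : ℝ => ρ * klReal u x) w :=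
      (continuousAt_klReal continuousAt_const continuousAt_id hw0 hw1).const_mul ρ
    exact (hc.eventually (lt_mem_nhds hM)).filter_mono nhdsWithin_le_nhds
  · have hu1 : (u : ℝ) < 1 := by rw [← hw1]; exact huw
    rw [hw1]
    have h1 : Tendsto (fun x : ℝ => 1 - x) (𝓝[<] 1) (𝓝[>] 0) := by
      refine tendsto_nhdsWithin_iff.2 ⟨?_, ?_⟩
      · have : Tendsto (fun x : ℝ => 1 - x) (𝓝 1) (𝓝 (1 - 1)) := tendsto_id.const_sub 1
        rw [sub_self] at this
        exact this.mono_left nhdsWithin_le_nhds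
      · filter_upwards [self_mem_nhdsWithin] with x hx
        exact sub_pos.2 (mem_Iio.1 hx)
    have h2 : Tendsto (fun x : ℝ => (1 - (u : ℝ)) * -Real.log (1 - x)) (𝓝[<] 1) atTop :=
      (tendsto_neg_atBot_atTop.comp (Real.tendsto_log_nhdsGT_zero.comp h1)).const_mul_atTop
        (sub_pos.2 hu1)
    have h3 : Tendsto (fun x : ℝ => -Real.binEntropy u - u * Real.log x) (𝓝[<] 1)
        (𝓝 (-Real.binEntropy u - u * Real.log 1)) :=
      ((Real.continuousAt_log one_ne_zero).tendsto.mono_left nhdsWithin_le_nhds).const_mul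
        (u : ℝ) |>.const_sub _
    have h4 := (h3.add_atTop h2).const_mul_atTop hρ
    filter_upwards [h4.eventually_gt_atTop M] with x hx
    refine hx.trans_eq ?_
    rw [klReal]
    ring

lemma exists_between_lt_mul_klReal {ρ : ℝ} (hρ : 0 < ρ) {u w : unitInterval} {M : ℝ}
    (hM : (M : EReal) < (ρ : EReal) * binEntropy u w) (huw : u ≠ w) :
    ∃ x : ℝ, 0 < x ∧ x < 1 ∧ (x - u) * (x - w) < 0 ∧ M < ρ * klReal u x := by
  rcases huw.lt_or_gt with h | h
  · obtain ⟨x, hx, hux, hxw⟩ := ((eventually_lt_mul_klReal hρ hM h).and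
      (Ioo_mem_nhdsLT (show (u : ℝ) < w from h))).exists
    exact ⟨x, u.2.1.trans_lt hux, hxw.trans_le w.2.2,
      mul_neg_of_pos_of_neg (sub_pos.2 hux) (sub_neg.2 hxw), hx⟩
  · rw [← binEntropy_symm] at hM
    have h' : unitInterval.symm u < unitInterval.symm w := by
      rw [← Subtype.coe_lt_coe, unitInterval.coe_symm_eq, unitInterval.coe_symm_eq]
      have : (w : ℝ) < u := h
      linarith
    obtain ⟨x, hx, hux, hxw⟩ := ((eventually_lt_mul_klReal hρ hM h').and
      (Ioo_mem_nhdsLT (show (unitInterval.symm u : ℝ) < unitInterval.symm w from h'))).exists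
    rw [unitInterval.coe_symm_eq] at hx hux hxw
    have hu := u.2.2
    have hw := w.2.1
    refine ⟨1 - x, by linarith, by linarith,
      mul_neg_of_neg_of_pos (by linarith) (by linarith), ?_⟩
    rw [← klReal_one_sub, sub_sub_cancel]
    exact hx

/-- The neighbourhood consists of the points on the far side of a threshold `y` strictly between `u`
and `w`. The threshold still separates it from means near `u`, so the bound is uniform in the
parameters and in `γ`. -/
lemma exists_isOpen_betaLaw_le {ρ : ℝ} (hρ : 0 ≤ ρ) {u w : unitInterval} {M : ℝ}
    (hM : (M : EReal) < (ρ : EReal) * binEntropy u w) :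
    ∃ N : Set unitInterval, IsOpen N ∧ w ∈ N ∧ ∀ᶠ x : ℝ × ℝ in 𝓝 (ρ, (u : ℝ)),
      x.2 ∈ Icc (0 : ℝ) 1 → ∀ γ : ℝ, 0 < γ →
        betaLaw (γ * x.1 * x.2) (γ * x.1 * (1 - x.2)) N ≤
          ENNReal.ofReal (Real.exp (-(γ * M))) := by
  -- Negative `M` needs only total mass one; this absorbs the degenerate cases `ρ = 0` and `u = w`.
  rcases lt_or_ge M 0 with hM0 | hM0
  · refine ⟨univ, isOpen_univ, mem_univ _, Eventually.of_forall fun x _ γ hγ => ?_⟩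
    rw [measure_univ, ENNReal.one_le_ofReal, Real.one_le_exp_iff]
    nlinarith
  have hM0' : (0 : EReal) ≤ M := by exact_mod_cast hM0
  have hρ' : 0 < ρ := hρ.lt_of_ne' fun h => by
    rw [h, EReal.coe_zero, zero_mul] at hM
    exact absurd hM (not_lt.2 hM0')
  have huw : u ≠ w := by
    rintro rfl
    rw [binEntropy_self, mul_zero] at hM
    exact absurd hM (not_lt.2 hM0')
  obtain ⟨y, hy0, hy1, hyu, hMy⟩ := exists_between_lt_mul_klReal hρ' hM huw
  refine ⟨{x | (y - u) * (y - x) < 0}, isOpen_lt (by fun_prop) continuous_const, hyu, ?_⟩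
  have hne : y - u ≠ 0 := fun h => by simp [h] at hyu
  have e1 : ∀ᶠ x : ℝ × ℝ in 𝓝 (ρ, (u : ℝ)), M < x.1 * klReal x.2 y := by
    have hc : ContinuousAt (fun x : ℝ × ℝ => x.1 * klReal x.2 y) (ρ, (u : ℝ)) :=
      continuousAt_fst.mul (continuousAt_klReal continuousAt_snd continuousAt_const hy0 hy1)
    exact hc.eventually (lt_mem_nhds hMy)
  have e2 : ∀ᶠ x : ℝ × ℝ in 𝓝 (ρ, (u : ℝ)), 0 < (y - x.2) * (y - u) := by
    have hc : ContinuousAt (fun x : ℝ × ℝ => (y - x.2) * (y - u)) (ρ, (u : ℝ)) := by fun_prop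
    exact hc.eventually (lt_mem_nhds (mul_self_pos.2 hne))
  have e3 : ∀ᶠ x : ℝ × ℝ in 𝓝 (ρ, (u : ℝ)), 0 < x.1 :=
    continuousAt_fst.eventually (lt_mem_nhds hρ')
  filter_upwards [e1, e2, e3] with x h1 h2 h3 hx γ hγ
  refine (betaLaw_le (mul_pos hγ h3) hx hy0 hy1
    (isOpen_lt (by fun_prop) continuous_const).measurableSet fun v hv => ?_).trans ?_
  · by_contra! hlt
    have h4 := mul_neg_of_neg_of_pos (show (y - u) * (y - v) < 0 from hv) h2
    have h5 : (y - (u : ℝ)) * (y - v) * ((y - x.2) * (y - u)) =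
        (y - u) ^ 2 * ((y - x.2) * (y - v)) := by ring
    rw [h5] at h4
    exact absurd h4 (not_lt.2 (by positivity))
  · refine ENNReal.ofReal_le_ofReal (Real.exp_le_exp.2 ?_)
    rw [mul_assoc]
    exact neg_le_neg (mul_le_mul_of_nonneg_left h1.le hγ.le)

/-- The prefactor is kept explicit because the first level applies this at `u = 0`, where no
positive constant bounds it from below. -/
lemma exists_le_betaLaw {ρ u : ℝ} {w : unitInterval} (hw : 0 < (w : ℝ)) (hw1 : (w : ℝ) < 1)
    {M : ℝ} (hM : ρ * klReal u w < M) {N : Set unitInterval} (hNm : MeasurableSet N)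
    (hN : N ∈ 𝓝 w) :
    ∃ δ : ℝ, 0 < δ ∧ ∀ᶠ x : ℝ × ℝ in 𝓝 (ρ, u), 0 < x.1 → 0 < x.2 → x.2 < 1 →
      ∀ γ : ℝ, 0 < γ →
        ENNReal.ofReal (δ * (γ * x.1 * (x.2 * (1 - x.2)) / (γ * x.1 + 1)) *
          Real.exp (-(γ * M))) ≤ betaLaw (γ * x.1 * x.2) (γ * x.1 * (1 - x.2)) N := by
  have hc : ContinuousAt (fun q : (ℝ × ℝ) × ℝ => q.1.1 * klReal q.1.2 q.2) ((ρ, u), (w : ℝ)) := by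
    have h1 : ContinuousAt (fun q : (ℝ × ℝ) × ℝ => q.1.2) ((ρ, u), (w : ℝ)) := by fun_prop
    have h2 : ContinuousAt (fun q : (ℝ × ℝ) × ℝ => q.1.1) ((ρ, u), (w : ℝ)) := by fun_prop
    exact h2.mul (continuousAt_klReal h1 continuousAt_snd hw hw1)
  have hev := hc.eventually (gt_mem_nhds hM)
  rw [nhds_prod_eq, eventually_prod_iff] at hev
  obtain ⟨p, hp, q, hq, hpq⟩ := hev
  obtain ⟨V, hV, hVN⟩ := mem_nhds_subtype _ _ _ |>.1 hN
  obtain ⟨a, b, hab, hsub⟩ := mem_nhds_iff_exists_Ioo_subset.1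
    (inter_mem (inter_mem hq hV) (Ioo_mem_nhds hw hw1))
  obtain ⟨a', ha', ha'w⟩ := exists_between (max_lt hab.1 hw)
  obtain ⟨b', hwb', hb'⟩ := exists_between (lt_min hab.2 hw1)
  refine ⟨b' - a', by linarith, ?_⟩
  filter_upwards [hp] with x hx h1 h2 h3 γ hγ
  have hIoo : Ioo a' b' ⊆ Ioo a b := fun y hy =>
    ⟨(le_max_left _ _).trans_lt (ha'.trans hy.1), hy.2.trans (hb'.trans_le (min_le_left _ _))⟩
  refine le_trans (le_of_eq ?_) (le_betaLaw (K := M / x.1) (mul_pos hγ h1) h2 h3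
    ((le_max_right _ _).trans_lt ha') (hb'.trans_le (min_le_right _ _)) hNm
    (fun y hy => hVN (hsub (hIoo hy)).1.2) fun y hy => ?_)
  · congr 3
    field_simp
  · rw [le_div_iff₀ h1, mul_comm]
    exact (hpq hx (hsub (hIoo hy)).1.1).le

lemma exists_const_le_betaLaw {ρ u : ℝ} (hρ : 0 < ρ) (hu : 0 < u) (hu1 : u < 1)
    {w : unitInterval} (hw : 0 < (w : ℝ)) (hw1 : (w : ℝ) < 1)
    {M : ℝ} (hM : ρ * klReal u w < M) {N : Set unitInterval} (hNm : MeasurableSet N)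
    (hN : N ∈ 𝓝 w) :
    ∃ C : ℝ, 0 < C ∧ ∀ᶠ x : ℝ × ℝ in 𝓝 (ρ, u), ∀ γ : ℝ, 1 ≤ γ →
      ENNReal.ofReal (C * Real.exp (-(γ * M))) ≤
        betaLaw (γ * x.1 * x.2) (γ * x.1 * (1 - x.2)) N := by
  obtain ⟨δ, hδ, hev⟩ := exists_le_betaLaw hw hw1 hM hNm hN
  have hκ : 0 < ρ * (u * (1 - u)) / (ρ + 1) := by
    have := sub_pos.2 hu1
    positivity
  refine ⟨δ * (ρ * (u * (1 - u)) / (ρ + 1) / 2), by positivity, ?_⟩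
  have e1 : ∀ᶠ x : ℝ × ℝ in 𝓝 (ρ, u),
      ρ * (u * (1 - u)) / (ρ + 1) / 2 < x.1 * (x.2 * (1 - x.2)) / (x.1 + 1) := by
    have hc : ContinuousAt (fun x : ℝ × ℝ => x.1 * (x.2 * (1 - x.2)) / (x.1 + 1)) (ρ, u) := by
      refine ContinuousAt.div (by fun_prop) (by fun_prop) ?_
      simp only
      positivity
    exact hc.eventually (lt_mem_nhds (half_lt_self hκ))
  have e2 : ∀ᶠ x : ℝ × ℝ in 𝓝 (ρ, u), 0 < x.1 := continuousAt_fst.eventually (lt_mem_nhds hρ)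
  have e3 : ∀ᶠ x : ℝ × ℝ in 𝓝 (ρ, u), 0 < x.2 := continuousAt_snd.eventually (lt_mem_nhds hu)
  have e4 : ∀ᶠ x : ℝ × ℝ in 𝓝 (ρ, u), x.2 < 1 := continuousAt_snd.eventually (gt_mem_nhds hu1)
  filter_upwards [hev, e1, e2, e3, e4] with x h0 h1 h2 h3 h4 γ hγ
  refine le_trans (ENNReal.ofReal_le_ofReal ?_) (h0 h2 h3 h4 γ (by linarith))
  refine mul_le_mul_of_nonneg_right (mul_le_mul_of_nonneg_left (h1.le.trans ?_) hδ.le)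
    (Real.exp_pos _).le
  have h5 : 0 < x.2 * (1 - x.2) := mul_pos h3 (sub_pos.2 h4)
  rw [div_le_div_iff₀ (by positivity) (by positivity)]
  have h6 : x.1 ≤ γ * x.1 := le_mul_of_one_le_left h2.le hγ
  -- The prefactor increases with `γ`, so its value at `γ = 1` is a lower bound.
  nlinarith [mul_nonneg (sub_nonneg.2 h6) h5.le]

/-! ### The joint law of both levels of stick-breaking proportions -/

lemma infinitePi_setOf_forall_fin (μ : ℕ → Measure unitInterval)
    [∀ n, IsProbabilityMeasure (μ n)] {m : ℕ} {A : Fin m → Set unitInterval}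
    (hA : ∀ k, MeasurableSet (A k)) :
    Measure.infinitePi μ {x | ∀ k : Fin m, x k ∈ A k} = ∏ k : Fin m, μ k (A k) := by
  have h1 : {x : ℕ → unitInterval | ∀ k : Fin m, x k ∈ A k} =
      Set.pi (Finset.range m) fun n => if h : n < m then A ⟨n, h⟩ else univ := by
    ext x
    simp only [mem_ofPred_eq, Set.mem_pi, Finset.coe_range, mem_Iio]
    refine ⟨fun h n hn => by simpa [hn] using h ⟨n, hn⟩, fun h k => by simpa using h k k.2⟩
  rw [h1, Measure.infinitePi_pi, ← Fin.prod_univ_eq_prod_range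
    (fun n => μ n (if h : n < m then A ⟨n, h⟩ else univ))]
  · simp
  · intro n _
    split_ifs
    · exact hA _
    · exact MeasurableSet.univ

lemma prod_Iio_fin {M : Type*} [CommMonoid M] (f : ℕ → M) {m : ℕ} (k : Fin m) :
    ∏ j ∈ Finset.Iio k, f j = ∏ j ∈ Finset.Iio (k : ℕ), f j := by
  rw [← Fin.map_valEmbedding_Iio, Finset.prod_map]
  rfl

lemma stick_fin (w : ℕ → unitInterval) {m : ℕ} (k : Fin m) :
    stick (fun j : Fin m => w j) k = stick w k := by
  rw [stick, stick, prod_Iio_fin fun j => 1 - (w j : ℝ)]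

/-- The joint law of the proportions `((U_1, U_2, …), (W_1, W_2, …))`. -/
def jointLaw (α β : ℝ) : Measure ((ℕ → unitInterval) × (ℕ → unitInterval)) :=
  (Measure.infinitePi fun _ : ℕ => betaLaw 1 α) ⊗ₘ
    (levelTwoKernel β).comap stickBreaking measurable_stickBreaking

/-- The joint law of the first `m` proportions on both levels. -/
def jointFin (m : ℕ) (α β : ℝ) : Measure ((Fin m → unitInterval) × (Fin m → unitInterval)) :=
  (jointLaw α β).map fun p => (fun k => p.1 k, fun k => p.2 k)

lemma measurable_restrict_fin (m : ℕ) :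
    Measurable fun p : (ℕ → unitInterval) × (ℕ → unitInterval) =>
      ((fun k => p.1 k, fun k => p.2 k) : (Fin m → unitInterval) × (Fin m → unitInterval)) := by
  fun_prop

instance (α β : ℝ) : IsProbabilityMeasure (jointLaw α β) := by
  unfold jointLaw; infer_instance

instance (m : ℕ) (α β : ℝ) : IsProbabilityMeasure (jointFin m α β) :=
  Measure.isProbabilityMeasure_map (measurable_restrict_fin m).aemeasurable

lemma hdpMassLaw_apply (α β : ℝ) {S : Set simplexInf} (hS : MeasurableSet S) :
    hdpMassLaw α β S = jointLaw α β {p | stickBreaking p.2 ∈ S} := by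
  have hS' := measurable_stickBreaking hS
  rw [hdpMassLaw, Measure.map_apply measurable_stickBreaking hS,
    Measure.bind_apply hS' (levelTwoKernel β).aemeasurable, gemLaw,
    lintegral_map (Kernel.measurable_coe _ hS') measurable_stickBreaking, jointLaw]
  exact (Measure.compProd_apply (μ := Measure.infinitePi fun _ : ℕ => betaLaw 1 α)
    (κ := (levelTwoKernel β).comap stickBreaking measurable_stickBreaking)
    (measurable_snd hS')).symm

lemma hdpMassLaw_setOf (α β : ℝ) {m : ℕ} {V : Set (Fin m → ℝ)} (hV : IsOpen V) :
    hdpMassLaw α β {z | (fun k : Fin m => z.1 k) ∈ V} = jointFin m α β {p | stick p.2 ∈ V} := by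
  have h1 : Measurable fun z : simplexInf => (fun k : Fin m => z.1 k) :=
    measurable_pi_lambda _ fun k => (measurable_pi_apply _).comp measurable_subtype_coe
  have h2 : Measurable fun p : (Fin m → unitInterval) × (Fin m → unitInterval) => stick p.2 := by
    refine measurable_pi_lambda _ fun k => ?_
    unfold stick
    fun_prop
  refine (hdpMassLaw_apply _ _ (h1 hV.measurableSet)).trans ?_
  refine Eq.trans ?_
    (Measure.map_apply (measurable_restrict_fin m) (h2 hV.measurableSet)).symm
  congr 1
  ext p
  have : stick (fun k : Fin m => p.2 k) = fun k : Fin m => stick p.2 k :=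
    funext fun k => stick_fin p.2 k
  simp only [mem_preimage, mem_ofPred_eq, this]
  rfl

/-- With `R_k = ∏_{j<k} (1 - U_j)` the stick left before step `k`, one has `V_k = R_k U_k`, and the
stick left after step `k` is `R_k (1 - U_k)`. -/
lemma levelTwoMeasure_stickBreaking (β : ℝ) (U : ℕ → unitInterval) {m : ℕ}
    {B : Fin m → Set unitInterval} (hB : ∀ k, MeasurableSet (B k)) :
    levelTwoMeasure β (stickBreaking U) {w | ∀ k : Fin m, w k ∈ B k} =
      ∏ k : Fin m, betaLaw (β * (∏ j ∈ Finset.Iio k, (1 - (U j : ℝ))) * U k)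
        (β * (∏ j ∈ Finset.Iio k, (1 - (U j : ℝ))) * (1 - U k)) (B k) := by
  rw [levelTwoMeasure, infinitePi_setOf_forall_fin _ hB]
  refine Finset.prod_congr rfl fun k _ => ?_
  have h1 : (1 - ∑ n ∈ Finset.Iic (k : ℕ), (stickBreaking U).1 n) =
      (∏ j ∈ Finset.Iio k, (1 - (U j : ℝ))) * (1 - U k) := by
    have h3 : Finset.Iic (k : ℕ) = Finset.range (k + 1) := by
      ext; simp
    rw [h3, prod_Iio_fin fun j => 1 - (U j : ℝ), Nat.Iio_eq_range, ← Finset.prod_range_succ]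
    have := sum_range_stick U (k + 1)
    simp only [stickBreaking]
    linarith
  have h2 : (stickBreaking U).1 k = (∏ j ∈ Finset.Iio k, (1 - (U j : ℝ))) * U k := by
    rw [prod_Iio_fin fun j => 1 - (U j : ℝ)]
    rfl
  rw [h1, h2, mul_assoc, mul_assoc]

lemma jointFin_prod (m : ℕ) (α β : ℝ) {A B : Fin m → Set unitInterval}
    (hA : ∀ k, MeasurableSet (A k)) (hB : ∀ k, MeasurableSet (B k)) :
    jointFin m α β (univ.pi A ×ˢ univ.pi B) =
      ∫⁻ U in {U : ℕ → unitInterval | ∀ k : Fin m, U k ∈ A k}, ∏ k : Fin m,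
        betaLaw (β * (∏ j ∈ Finset.Iio k, (1 - (U j : ℝ))) * U k)
          (β * (∏ j ∈ Finset.Iio k, (1 - (U j : ℝ))) * (1 - U k)) (B k)
        ∂Measure.infinitePi fun _ : ℕ => betaLaw 1 α := by
  have hm : ∀ {C : Fin m → Set unitInterval}, (∀ k, MeasurableSet (C k)) →
      MeasurableSet {U : ℕ → unitInterval | ∀ k : Fin m, U k ∈ C k} := fun {C} hC => by
    rw [ofPred_forall]
    exact MeasurableSet.iInter fun k => measurable_pi_apply _ (hC k)
  have hpre : (fun p : (ℕ → unitInterval) × (ℕ → unitInterval) =>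
      ((fun k => p.1 k, fun k => p.2 k) : (Fin m → unitInterval) × (Fin m → unitInterval))) ⁻¹'
      (univ.pi A ×ˢ univ.pi B) = {U : ℕ → unitInterval | ∀ k : Fin m, U k ∈ A k} ×ˢ
        {W : ℕ → unitInterval | ∀ k : Fin m, W k ∈ B k} := by
    ext p; simp
  rw [jointFin, Measure.map_apply (measurable_restrict_fin m)
    ((MeasurableSet.univ_pi hA).prod (MeasurableSet.univ_pi hB)), hpre, jointLaw,
    Measure.compProd_apply_prod (hm hA) (hm hB)]
  refine lintegral_congr fun U => ?_
  exact levelTwoMeasure_stickBreaking β U hB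

lemma jointFin_prod_le {m : ℕ} {α β : ℝ} {A B : Fin m → Set unitInterval}
    (hA : ∀ k, MeasurableSet (A k)) (hB : ∀ k, MeasurableSet (B k)) {x y : Fin m → ℝ≥0∞}
    (hx : ∀ k, betaLaw 1 α (A k) ≤ x k)
    (hy : ∀ U : Fin m → unitInterval, (∀ k, U k ∈ A k) → ∀ k,
      betaLaw (β * (∏ j ∈ Finset.Iio k, (1 - (U j : ℝ))) * U k)
        (β * (∏ j ∈ Finset.Iio k, (1 - (U j : ℝ))) * (1 - U k)) (B k) ≤ y k) :
    jointFin m α β (univ.pi A ×ˢ univ.pi B) ≤ (∏ k, x k) * ∏ k, y k := by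
  rw [jointFin_prod m α β hA hB]
  refine (setLIntegral_mono (g := fun _ => ∏ k, y k) measurable_const
    fun U (hU : U ∈ {U : ℕ → unitInterval | ∀ k : Fin m, U k ∈ A k}) => Finset.prod_le_prod' fun k _ => hy (fun k => U k) (fun j => hU j) k).trans ?_
  rw [setLIntegral_const, infinitePi_setOf_forall_fin _ hA, mul_comm]
  exact mul_le_mul_left (Finset.prod_le_prod' fun k _ => hx k) _

lemma le_jointFin_prod {m : ℕ} {α β : ℝ} {A B : Fin m → Set unitInterval}
    (hA : ∀ k, MeasurableSet (A k)) (hB : ∀ k, MeasurableSet (B k)) {x y : Fin m → ℝ≥0∞}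
    (hx : ∀ k, x k ≤ betaLaw 1 α (A k))
    (hy : ∀ U : Fin m → unitInterval, (∀ k, U k ∈ A k) → ∀ k,
      y k ≤ betaLaw (β * (∏ j ∈ Finset.Iio k, (1 - (U j : ℝ))) * U k)
        (β * (∏ j ∈ Finset.Iio k, (1 - (U j : ℝ))) * (1 - U k)) (B k)) :
    (∏ k, x k) * ∏ k, y k ≤ jointFin m α β (univ.pi A ×ˢ univ.pi B) := by
  have hm : MeasurableSet {U : ℕ → unitInterval | ∀ k : Fin m, U k ∈ A k} := by
    rw [ofPred_forall]
    exact MeasurableSet.iInter fun k => measurable_pi_apply _ (hA k)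
  rw [jointFin_prod m α β hA hB]
  refine le_trans ?_ (setLIntegral_mono' hm fun U hU =>
    Finset.prod_le_prod' fun k _ => hy (fun k => U k) (fun j => hU j) k)
  rw [setLIntegral_const, infinitePi_setOf_forall_fin _ hA, mul_comm]
  exact mul_le_mul_right (Finset.prod_le_prod' fun k _ => hx k) _

/-! ### Finite sums of extended reals -/

lemma sum_ereal_ne_bot {κ : Type*} {t : Finset κ} {f : κ → EReal} (hf : ∀ k ∈ t, f k ≠ ⊥) :
    ∑ k ∈ t, f k ≠ ⊥ := by
  classical
  induction t using Finset.induction_on with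
  | empty => simp
  | insert k t hk ih =>
    rw [Finset.sum_insert hk, EReal.add_ne_bot_iff]
    exact ⟨hf k (Finset.mem_insert_self k t), ih fun j hj => hf j (Finset.mem_insert_of_mem hj)⟩

lemma sum_ereal_eq_top {κ : Type*} {t : Finset κ} {f : κ → EReal} (hf : ∀ k ∈ t, f k ≠ ⊥)
    {k : κ} (hk : k ∈ t) (htop : f k = ⊤) : ∑ k ∈ t, f k = ⊤ := by
  classical
  rw [← Finset.add_sum_erase t f hk, htop, EReal.top_add_of_ne_bot]
  exact sum_ereal_ne_bot fun j hj => hf j (Finset.mem_of_mem_erase hj)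

lemma sum_ereal_coe {κ : Type*} (t : Finset κ) (f : κ → ℝ) :
    ∑ k ∈ t, (f k : EReal) = ((∑ k ∈ t, f k : ℝ) : EReal) := by
  classical
  induction t using Finset.induction_on with
  | empty => simp
  | insert k t hk ih => rw [Finset.sum_insert hk, Finset.sum_insert hk, ih, EReal.coe_add]

lemma exists_real_lt_of_lt_add {x y : EReal} (hx : x ≠ ⊥) (hy : y ≠ ⊥) {M : ℝ}
    (h : (M : EReal) < x + y) : ∃ r : ℝ, (r : EReal) < x ∧ ((M - r : ℝ) : EReal) < y := by
  induction x using EReal.rec with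
  | bot => exact absurd rfl hx
  | top =>
    induction y using EReal.rec with
    | bot => exact absurd rfl hy
    | top => exact ⟨0, EReal.coe_lt_top _, EReal.coe_lt_top _⟩
    | coe y =>
      refine ⟨M - y + 1, EReal.coe_lt_top _, ?_⟩
      rw [EReal.coe_lt_coe_iff]
      linarith
  | coe x =>
    induction y using EReal.rec with
    | bot => exact absurd rfl hy
    | top =>
      refine ⟨x - 1, ?_, EReal.coe_lt_top _⟩
      rw [EReal.coe_lt_coe_iff]
      linarith
    | coe y =>
      rw [← EReal.coe_add, EReal.coe_lt_coe_iff] at h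
      refine ⟨(M - y + x) / 2, ?_, ?_⟩ <;>
      · rw [EReal.coe_lt_coe_iff]
        linarith

/-- Distributes a total exponent among the factors, some of which may have infinite rate. -/
lemma exists_real_lt_of_lt_sum {κ : Type*} (t : Finset κ) {f : κ → EReal}
    (hf : ∀ k ∈ t, f k ≠ ⊥) {M : ℝ} (h : (M : EReal) < ∑ k ∈ t, f k) :
    ∃ g : κ → ℝ, (∀ k ∈ t, (g k : EReal) < f k) ∧ M < ∑ k ∈ t, g k := by
  classical
  induction t using Finset.induction_on generalizing M with
  | empty =>
    refine ⟨fun _ => 0, by simp, ?_⟩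
    simpa using h
  | insert k t hk ih =>
    have hf' : ∀ j ∈ t, f j ≠ ⊥ := fun j hj => hf j (Finset.mem_insert_of_mem hj)
    rw [Finset.sum_insert hk] at h
    obtain ⟨r, hr, hr'⟩ :=
      exists_real_lt_of_lt_add (hf k (Finset.mem_insert_self k t)) (sum_ereal_ne_bot hf') h
    obtain ⟨g, hg, hgM⟩ := ih hf' hr'
    refine ⟨Function.update g k r, fun j hj => ?_, ?_⟩
    · rcases Finset.mem_insert.1 hj with rfl | hj'
      · simpa using hr
      · rw [Function.update_of_ne (ne_of_mem_of_not_mem hj' hk)]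
        exact hg j hj'
    · rw [Finset.sum_insert hk, Function.update_self, Finset.sum_congr rfl fun j hj =>
        Function.update_of_ne (ne_of_mem_of_not_mem hj hk) r g]
      linarith

/-! ### Local bounds for the joint law -/

/-- The cost of `(u, w)` with weights `a` and `b`, with value `∞` if some `u_k` equals `1`. -/
def extCost (a b : ℝ) {m : ℕ} (u w : Fin m → unitInterval) : EReal :=
  ∑ k : Fin m, ((a : EReal) * binEntropy 0 (u k) +
    ((b * ∏ j ∈ Finset.Iio k, (1 - (u j : ℝ)) : ℝ) : EReal) * binEntropy (u k) (w k))

/-- The cost of `(u, w)` as a real number, meaningful when it is finite. -/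
def realCost (a b : ℝ) {m : ℕ} (u w : Fin m → unitInterval) : ℝ :=
  ∑ k : Fin m, (a * klReal 0 (u k) +
    b * (∏ j ∈ Finset.Iio k, (1 - (u j : ℝ))) * klReal (u k) (w k))

lemma prod_one_sub_nonneg {m : ℕ} (u : Fin m → unitInterval) (t : Finset (Fin m)) :
    0 ≤ ∏ j ∈ t, (1 - (u j : ℝ)) :=
  Finset.prod_nonneg fun j _ => sub_nonneg.2 (u j).2.2

lemma coe_mul_ne_bot {x : ℝ} (hx : 0 ≤ x) {y : EReal} (hy : y ≠ ⊥) : (x : EReal) * y ≠ ⊥ := by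
  rcases hx.eq_or_lt with rfl | hx
  · simp
  induction y using EReal.rec with
  | bot => exact absurd rfl hy
  | top => rw [EReal.coe_mul_top_of_pos hx]; simp
  | coe y => rw [← EReal.coe_mul]; exact EReal.coe_ne_bot _

lemma prod_ofReal_exp {κ : Type*} (t : Finset κ) (γ : ℝ) (f : κ → ℝ) :
    ∏ k ∈ t, ENNReal.ofReal (Real.exp (-(γ * f k))) =
      ENNReal.ofReal (Real.exp (-(γ * ∑ k ∈ t, f k))) := by
  rw [← ENNReal.ofReal_prod_of_nonneg fun k _ => (Real.exp_pos _).le, ← Real.exp_sum,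
    Finset.sum_neg_distrib, Finset.mul_sum]

section LocalBounds

variable {ι : Type*} {l : Filter ι} {α β γ : ι → ℝ} {a b : ℝ}

lemma tendsto_betaLaw_one_params (hα : Tendsto α l atTop) (hγ : Tendsto γ l atTop)
    (hA : Tendsto (fun i => α i / γ i) l (𝓝 a)) :
    Tendsto (fun i => ((1 + α i) / γ i, 1 / (1 + α i))) l (𝓝 (a, 0)) := by
  refine Tendsto.prodMk_nhds ?_ ?_
  · have := (hγ.inv_tendsto_atTop).add hA
    rw [zero_add] at this
    refine this.congr fun i => ?_
    rw [Pi.inv_apply, add_div, one_div]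
  · have := (tendsto_atTop_add_const_left l 1 hα).inv_tendsto_atTop
    refine this.congr fun i => ?_
    rw [Pi.inv_apply, one_div]

lemma betaLaw_one_params {α γ : ℝ} (hα : 0 < α) (hγ : 0 < γ) :
    betaLaw (γ * ((1 + α) / γ) * (1 / (1 + α))) (γ * ((1 + α) / γ) * (1 - 1 / (1 + α))) =
      betaLaw 1 α := by
  congr 1 <;> field_simp
  ring

lemma exists_isOpen_betaLaw_one_le (ha : 0 < a) (hα : Tendsto α l atTop)
    (hγ : Tendsto γ l atTop) (hA : Tendsto (fun i => α i / γ i) l (𝓝 a)) {u : unitInterval}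
    {M : ℝ} (hM : (M : EReal) < (a : EReal) * binEntropy 0 u) :
    ∃ N : Set unitInterval, IsOpen N ∧ u ∈ N ∧
      ∀ᶠ i in l, betaLaw 1 (α i) N ≤ ENNReal.ofReal (Real.exp (-(γ i * M))) := by
  obtain ⟨N, hN, huN, hev⟩ := exists_isOpen_betaLaw_le ha.le hM
  refine ⟨N, hN, huN, ?_⟩
  filter_upwards [(tendsto_betaLaw_one_params hα hγ hA).eventually hev,
    hα.eventually_gt_atTop 0, hγ.eventually_gt_atTop 0] with i h1 h2 h3
  have h4 := h1 ⟨by positivity, by rw [div_le_one (by linarith)]; linarith⟩ (γ i) h3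
  simpa only [betaLaw_one_params h2 h3] using h4

/-- Here the mean `1 / (1 + α)` tends to `0` and the prefactor is of order `1 / α`. As `α ≤ γ`, this
is at least of order `1 / γ`, which the slack between `M'` and `M` absorbs. -/
lemma exists_const_le_betaLaw_one (hα : Tendsto α l atTop)
    (hγ : Tendsto γ l atTop) (hαγ : ∀ i, α i ≤ γ i) (hA : Tendsto (fun i => α i / γ i) l (𝓝 a))
    {u : unitInterval} (hu : 0 < (u : ℝ)) (hu1 : (u : ℝ) < 1) {M : ℝ} (hM : a * klReal 0 u < M)
    {N : Set unitInterval} (hNm : MeasurableSet N) (hN : N ∈ 𝓝 u) :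
    ∃ C : ℝ, 0 < C ∧
      ∀ᶠ i in l, ENNReal.ofReal (C * Real.exp (-(γ i * M))) ≤ betaLaw 1 (α i) N := by
  obtain ⟨M', hM', hM'M⟩ := exists_between hM
  obtain ⟨δ, hδ, hev⟩ := exists_le_betaLaw hu hu1 hM' hNm hN
  have hε : 0 < M - M' := sub_pos.2 hM'M
  refine ⟨δ * ((M - M') / 6), by positivity, ?_⟩
  filter_upwards [(tendsto_betaLaw_one_params hα hγ hA).eventually hev,
    hα.eventually_ge_atTop 1, hγ.eventually_gt_atTop 0] with i h1 h2 h3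
  have hα0 : 0 < α i := by linarith
  have h4 := h1 (by positivity) (by positivity) (by rw [div_lt_one (by linarith)]; linarith)
    (γ i) h3
  rw [betaLaw_one_params hα0 h3] at h4
  refine le_trans (ENNReal.ofReal_le_ofReal ?_) h4
  have e1 : γ i * ((1 + α i) / γ i) * (1 / (1 + α i) * (1 - 1 / (1 + α i))) /
      (γ i * ((1 + α i) / γ i) + 1) = α i / ((1 + α i) * (2 + α i)) := by
    field_simp
    ring
  -- For `α ≥ 1`, `(1 + α) (2 + α) ≤ 2 α * 3 α ≤ 6 α γ`.
  have e2 : 1 / (6 * γ i) ≤ α i / ((1 + α i) * (2 + α i)) := by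
    rw [div_le_div_iff₀ (by positivity) (by positivity)]
    nlinarith [hαγ i]
  have e3 : Real.exp (-(γ i * M)) =
      Real.exp (-(γ i * M')) * (Real.exp (γ i * (M - M')))⁻¹ := by
    rw [← Real.exp_neg, ← Real.exp_add]
    ring_nf
  have e4 : (M - M') / 6 * (Real.exp (γ i * (M - M')))⁻¹ ≤ 1 / (6 * γ i) := by
    have h5 := Real.add_one_le_exp (γ i * (M - M'))
    rw [← div_eq_mul_inv, div_le_div_iff₀ (Real.exp_pos _) (by positivity)]
    linarith
  rw [e1, e3]
  calc _ = δ * ((M - M') / 6 * (Real.exp (γ i * (M - M')))⁻¹) * Real.exp (-(γ i * M')) := by ring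
    _ ≤ _ := mul_le_mul_of_nonneg_right
      (mul_le_mul_of_nonneg_left (e4.trans e2) hδ.le) (Real.exp_pos _).le

lemma tendsto_levelTwo_params (hB : Tendsto (fun i => β i / γ i) l (𝓝 b)) {m : ℕ}
    (u : Fin m → unitInterval) (k : Fin m) :
    Tendsto (fun q : ι × (Fin m → unitInterval) =>
      (β q.1 / γ q.1 * ∏ j ∈ Finset.Iio k, (1 - (q.2 j : ℝ)), (q.2 k : ℝ))) (l ×ˢ 𝓝 u)
      (𝓝 (b * ∏ j ∈ Finset.Iio k, (1 - (u j : ℝ)), (u k : ℝ))) := by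
  have h1 : Continuous fun v : Fin m → unitInterval => ∏ j ∈ Finset.Iio k, (1 - (v j : ℝ)) := by
    fun_prop
  have h2 : Continuous fun v : Fin m → unitInterval => (v k : ℝ) := by fun_prop
  exact ((hB.comp tendsto_fst).mul ((h1.tendsto u).comp tendsto_snd)).prodMk_nhds
    ((h2.tendsto u).comp tendsto_snd)

lemma exists_isOpen_box_subset {m : ℕ} {u : Fin m → unitInterval}
    {s : Set (Fin m → unitInterval)} (hs : s ∈ 𝓝 u) :
    ∃ A : Fin m → Set unitInterval, (∀ k, IsOpen (A k) ∧ u k ∈ A k) ∧ univ.pi A ⊆ s := by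
  obtain ⟨A, hA, hsub⟩ := isOpen_pi_iff'.1 isOpen_interior u (mem_interior_iff_mem_nhds.2 hs)
  exact ⟨A, hA, hsub.trans interior_subset⟩

lemma jointFin_upperDecay (ha : 0 < a) (hb : 0 < b) (hα : Tendsto α l atTop)
    (hγ : Tendsto γ l atTop) (hA : Tendsto (fun i => α i / γ i) l (𝓝 a))
    (hB : Tendsto (fun i => β i / γ i) l (𝓝 b)) {m : ℕ} {u w : Fin m → unitInterval}
    {M : ℝ} (hM : (M : EReal) < extCost a b u w) :
    ∃ N, IsOpen N ∧ (u, w) ∈ N ∧ UpperDecay l (fun i => jointFin m (α i) (β i)) γ N M := by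
  have hR : ∀ k : Fin m, 0 ≤ b * ∏ j ∈ Finset.Iio k, (1 - (u j : ℝ)) := fun k =>
    mul_nonneg hb.le (prod_one_sub_nonneg u _)
  rw [extCost, Finset.sum_add_distrib] at hM
  have hf : ∀ k ∈ Finset.univ, (a : EReal) * binEntropy 0 (u k) ≠ ⊥ := fun k _ =>
    coe_mul_ne_bot ha.le (binEntropy_ne_bot _ _)
  have hg : ∀ k ∈ Finset.univ, ((b * ∏ j ∈ Finset.Iio k, (1 - (u j : ℝ)) : ℝ) : EReal) *
      binEntropy (u k) (w k) ≠ ⊥ := fun k _ => coe_mul_ne_bot (hR k) (binEntropy_ne_bot _ _)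
  obtain ⟨r, hr, hr'⟩ :=
    exists_real_lt_of_lt_add (sum_ereal_ne_bot hf) (sum_ereal_ne_bot hg) hM
  obtain ⟨f, hf, hfM⟩ := exists_real_lt_of_lt_sum _ hf hr
  obtain ⟨g, hg, hgM⟩ := exists_real_lt_of_lt_sum _ hg hr'
  choose A hAo huA hA' using fun k =>
    exists_isOpen_betaLaw_one_le ha hα hγ hA (hf k (Finset.mem_univ k))
  choose B hBo hwB hB' using fun k =>
    exists_isOpen_betaLaw_le (hR k) (hg k (Finset.mem_univ k))
  have hev : ∀ᶠ q : ι × (Fin m → unitInterval) in l ×ˢ 𝓝 u, ∀ k, 0 < γ q.1 →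
      betaLaw (β q.1 * (∏ j ∈ Finset.Iio k, (1 - (q.2 j : ℝ))) * q.2 k)
        (β q.1 * (∏ j ∈ Finset.Iio k, (1 - (q.2 j : ℝ))) * (1 - q.2 k)) (B k) ≤
        ENNReal.ofReal (Real.exp (-(γ q.1 * g k))) := by
    refine eventually_all.2 fun k => ?_
    filter_upwards [(tendsto_levelTwo_params hB u k).eventually (hB' k)] with q hq hγq
    have := hq (q.2 k).2 _ hγq
    rwa [← mul_assoc (γ q.1), mul_div_cancel₀ _ hγq.ne'] at this
  obtain ⟨p, hp, s, hs, hps⟩ := eventually_prod_iff.1 hev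
  -- Shrinking the box of the first level makes the conditional bounds on `B k` hold for every `U`
  -- in it, so the integral over `U` factorises.
  obtain ⟨A', hA'o, hA's⟩ := exists_isOpen_box_subset hs
  refine ⟨univ.pi (fun k => A k ∩ A' k) ×ˢ univ.pi B,
    (isOpen_set_pi finite_univ fun k _ => (hAo k).inter (hA'o k).1).prod
      (isOpen_set_pi finite_univ fun k _ => hBo k),
    ⟨fun k _ => ⟨huA k, (hA'o k).2⟩, fun k _ => hwB k⟩, 1, one_pos, ?_⟩
  filter_upwards [hp, eventually_all.2 hA', hγ.eventually_gt_atTop 0] with i h1 h2 h3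
  refine (jointFin_prod_le (y := fun k => ENNReal.ofReal (Real.exp (-(γ i * g k)))) (fun k => ((hAo k).inter (hA'o k).1).measurableSet)
    (fun k => (hBo k).measurableSet)
    (fun k => (measure_mono inter_subset_left).trans (h2 k))
    (fun U hU k => hps h1 (hA's fun j _ => (hU j).2) k h3)).trans ?_
  rw [prod_ofReal_exp, prod_ofReal_exp, ← ENNReal.ofReal_mul (Real.exp_pos _).le,
    ← Real.exp_add, one_mul]
  refine ENNReal.ofReal_le_ofReal (Real.exp_le_exp.2 ?_)
  have : γ i * M ≤ γ i * (∑ k, f k + ∑ k, g k) :=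
    mul_le_mul_of_nonneg_left (by linarith) h3.le
  linarith

lemma exists_gt_sum_lt {κ : Type*} [Fintype κ] (f : κ → ℝ) {M : ℝ} (hM : ∑ k, f k < M) :
    ∃ g : κ → ℝ, (∀ k, f k < g k) ∧ ∑ k, g k < M := by
  have hc : ContinuousAt (fun ε : ℝ => ∑ k, (f k + ε)) 0 := by fun_prop
  have hev : ∀ᶠ ε : ℝ in 𝓝[>] 0, ∑ k, (f k + ε) < M :=
    (hc.eventually (gt_mem_nhds (by simpa using hM))).filter_mono nhdsWithin_le_nhds
  obtain ⟨ε, hε, hε0⟩ := (hev.and self_mem_nhdsWithin).exists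
  exact ⟨fun k => f k + ε, fun k => lt_add_of_pos_right _ hε0, hε⟩

lemma jointFin_lowerDecay_of_mem_Ioo (hb : 0 < b) (hα : Tendsto α l atTop)
    (hγ : Tendsto γ l atTop) (hαγ : ∀ i, α i ≤ γ i)
    (hA : Tendsto (fun i => α i / γ i) l (𝓝 a)) (hB : Tendsto (fun i => β i / γ i) l (𝓝 b))
    {m : ℕ} {u w : Fin m → unitInterval} (hu : ∀ k, (u k : ℝ) ∈ Ioo (0 : ℝ) 1)
    (hw : ∀ k, (w k : ℝ) ∈ Ioo (0 : ℝ) 1) {M : ℝ} (hM : realCost a b u w < M)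
    {N : Set ((Fin m → unitInterval) × (Fin m → unitInterval))} (hN : N ∈ 𝓝 (u, w)) :
    LowerDecay l (fun i => jointFin m (α i) (β i)) γ N M := by
  have hR : ∀ k : Fin m, 0 < b * ∏ j ∈ Finset.Iio k, (1 - (u j : ℝ)) := fun k =>
    mul_pos hb (Finset.prod_pos fun j _ => sub_pos.2 (hu j).2)
  rw [realCost, Finset.sum_add_distrib] at hM
  obtain ⟨f, hf, hfM⟩ := exists_gt_sum_lt (fun k => a * klReal 0 (u k)) (lt_sub_iff_add_lt.2 hM)
  obtain ⟨g, hg, hgM⟩ := exists_gt_sum_lt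
    (fun k => b * (∏ j ∈ Finset.Iio k, (1 - (u j : ℝ))) * klReal (u k) (w k))
    (lt_sub_comm.1 hfM)
  rw [nhds_prod_eq] at hN
  obtain ⟨N₁, hN₁, N₂, hN₂, hN₁₂⟩ := mem_prod_iff.1 hN
  obtain ⟨B, hB₀, hBN⟩ := exists_isOpen_box_subset hN₂
  choose D hD hD' using fun k => exists_const_le_betaLaw (hR k) (hu k).1 (hu k).2 (hw k).1
    (hw k).2 (hg k) (hB₀ k).1.measurableSet ((hB₀ k).1.mem_nhds (hB₀ k).2)
  have hev : ∀ᶠ q : ι × (Fin m → unitInterval) in l ×ˢ 𝓝 u, ∀ k, 1 ≤ γ q.1 →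
      ENNReal.ofReal (D k * Real.exp (-(γ q.1 * g k))) ≤
      betaLaw (β q.1 * (∏ j ∈ Finset.Iio k, (1 - (q.2 j : ℝ))) * q.2 k)
        (β q.1 * (∏ j ∈ Finset.Iio k, (1 - (q.2 j : ℝ))) * (1 - q.2 k)) (B k) := by
    refine eventually_all.2 fun k => ?_
    filter_upwards [(tendsto_levelTwo_params hB u k).eventually (hD' k)] with q hq hγq
    have := hq _ hγq
    rwa [← mul_assoc (γ q.1), mul_div_cancel₀ _ (by positivity)] at this
  obtain ⟨p, hp, s, hs, hps⟩ := eventually_prod_iff.1 hev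
  obtain ⟨A, hA₀, hAs⟩ := exists_isOpen_box_subset (inter_mem hN₁ hs)
  choose C hC hC' using fun k => exists_const_le_betaLaw_one hα hγ hαγ hA (hu k).1 (hu k).2
    (hf k) (hA₀ k).1.measurableSet ((hA₀ k).1.mem_nhds (hA₀ k).2)
  refine ⟨(∏ k, C k) * ∏ k, D k,
    mul_pos (Finset.prod_pos fun k _ => hC k) (Finset.prod_pos fun k _ => hD k), ?_⟩
  filter_upwards [hp, eventually_all.2 hC', hγ.eventually_ge_atTop 1] with i h1 h2 h3
  refine le_trans ?_ ((le_jointFin_prod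
    (y := fun k => ENNReal.ofReal (D k * Real.exp (-(γ i * g k)))) (fun k => (hA₀ k).1.measurableSet)
    (fun k => (hB₀ k).1.measurableSet) h2
    (fun U hU k => hps h1 (hAs fun j _ => hU j).2 k h3)).trans (measure_mono ?_))
  · have hC0 : 0 ≤ ∏ k, C k := Finset.prod_nonneg fun k _ => (hC k).le
    have hD0 : 0 ≤ ∏ k, D k := Finset.prod_nonneg fun k _ => (hD k).le
    simp only [ENNReal.ofReal_mul (hC _).le, ENNReal.ofReal_mul (hD _).le,
      Finset.prod_mul_distrib, prod_ofReal_exp]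
    rw [← ENNReal.ofReal_prod_of_nonneg fun k _ => (hC k).le,
      ← ENNReal.ofReal_prod_of_nonneg fun k _ => (hD k).le,
      ← ENNReal.ofReal_mul hC0, ← ENNReal.ofReal_mul hD0,
      ← ENNReal.ofReal_mul (mul_nonneg hC0 (Real.exp_pos _).le)]
    refine ENNReal.ofReal_le_ofReal ?_
    have h4 : Real.exp (-(γ i * M)) ≤
        Real.exp (-(γ i * ∑ k, f k)) * Real.exp (-(γ i * ∑ k, g k)) := by
      rw [← Real.exp_add, Real.exp_le_exp]
      have : γ i * (∑ k, f k + ∑ k, g k) ≤ γ i * M :=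
        mul_le_mul_of_nonneg_left (by linarith) (by linarith)
      linarith
    calc _ ≤ (∏ k, C k) * (∏ k, D k) *
          (Real.exp (-(γ i * ∑ k, f k)) * Real.exp (-(γ i * ∑ k, g k))) :=
        mul_le_mul_of_nonneg_left h4 (mul_nonneg hC0 hD0)
      _ = _ := by ring
  · exact (prod_mono (hAs.trans inter_subset_left) hBN).trans hN₁₂

/-- Points with zero coordinates are approached from inside: all zeros of `u` and `w` are replaced
by the same small `ε`, and the cost varies continuously along this path. -/
lemma jointFin_lowerDecay (hb : 0 < b) (hα : Tendsto α l atTop)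
    (hγ : Tendsto γ l atTop) (hαγ : ∀ i, α i ≤ γ i)
    (hA : Tendsto (fun i => α i / γ i) l (𝓝 a)) (hB : Tendsto (fun i => β i / γ i) l (𝓝 b))
    {m : ℕ} {u w : Fin m → unitInterval} (hu : ∀ k, (u k : ℝ) < 1)
    (hw0 : ∀ k, (w k : ℝ) = 0 → (u k : ℝ) = 0) (hw1 : ∀ k, (w k : ℝ) < 1) {M : ℝ}
    (hM : realCost a b u w < M)
    {N : Set ((Fin m → unitInterval) × (Fin m → unitInterval))} (hN : N ∈ 𝓝 (u, w)) :
    LowerDecay l (fun i => jointFin m (α i) (β i)) γ N M := by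
  let e : ℝ → unitInterval := projIcc (0 : ℝ) 1 zero_le_one
  let path : (Fin m → unitInterval) → ℝ → Fin m → unitInterval := fun v ε k =>
    if (v k : ℝ) = 0 then e ε else v k
  have hpath : ∀ v, Continuous (path v) := fun v => continuous_pi fun k => by
    simp only [path]
    split_ifs
    · exact continuous_projIcc
    · exact continuous_const
  have he0 : e 0 = 0 := projIcc_left zero_le_one
  have hpath0 : ∀ v, path v 0 = v := fun v => by
    ext k
    simp only [path]
    split_ifs with h
    · rw [he0, h]; rfl
    · rfl
  have hcoord : ∀ v k, Continuous fun ε => (path v ε k : ℝ) := fun v k =>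
    continuous_subtype_val.comp ((continuous_apply k).comp (hpath v))
  have hcost : ContinuousAt (fun ε => realCost a b (path u ε) (path w ε)) 0 := by
    unfold realCost
    refine tendsto_finsetSum _ fun k _ => ?_
    refine ContinuousAt.add (f := fun ε => a * klReal 0 (path u ε k)) (x := (0 : ℝ)) ?_
      (ContinuousAt.mul ?_ ?_)
    · simp only [klReal_zero_left]
      refine ContinuousAt.mul continuousAt_const (ContinuousAt.neg (ContinuousAt.log ?_ ?_))
      · exact (continuous_const.sub (hcoord u k)).continuousAt
      · rw [hpath0]; exact (sub_pos.2 (hu k)).ne'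
    · exact (continuous_const.mul (continuous_finsetProd _ fun j _ =>
        continuous_const.sub (hcoord u j))).continuousAt
    -- `klReal` need not be continuous where `w k = 0`; but then `u k = 0` too, both coordinates
    -- move together, and the relative entropy stays zero.
    · by_cases h : (w k : ℝ) = 0
      · have : (fun ε => klReal (path u ε k) (path w ε k)) = fun _ => (0 : ℝ) := by
          ext ε
          simp only [path, if_pos h, if_pos (hw0 k h), klReal_self]
        rw [this]
        exact continuousAt_const
      · refine continuousAt_klReal (hcoord u k).continuousAt (hcoord w k).continuousAt ?_ ?_
        · rw [hpath0]; exact (w k).2.1.lt_of_ne' h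
        · rw [hpath0]; exact hw1 k
  have h1 : ∀ᶠ ε in 𝓝[>] (0 : ℝ), realCost a b (path u ε) (path w ε) < M :=
    (hcost.eventually (gt_mem_nhds (by simpa only [hpath0] using hM))).filter_mono
      nhdsWithin_le_nhds
  have h2 : ∀ᶠ ε in 𝓝[>] (0 : ℝ), N ∈ 𝓝 (path u ε, path w ε) := by
    have hc : ContinuousAt (fun ε => (path u ε, path w ε)) 0 :=
      ((hpath u).prodMk (hpath w)).continuousAt
    refine (hc.eventually (p := fun x => N ∈ 𝓝 x) ?_).filter_mono nhdsWithin_le_nhds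
    simp only [hpath0]
    exact eventually_mem_nhds_iff.2 hN
  obtain ⟨ε, ⟨hε1, hε2⟩, hε⟩ := ((h1.and h2).and (Ioo_mem_nhdsGT one_pos)).exists
  have heε : (e ε : ℝ) ∈ Ioo (0 : ℝ) 1 := by
    simp only [e, projIcc_of_mem zero_le_one ⟨hε.1.le, hε.2.le⟩]
    exact hε
  have hIoo : ∀ v : Fin m → unitInterval, (∀ k, (v k : ℝ) < 1) →
      ∀ k, (path v ε k : ℝ) ∈ Ioo (0 : ℝ) 1 := fun v hv k => by
    simp only [path]
    split_ifs with h
    · exact heε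
    · exact ⟨(v k).2.1.lt_of_ne' h, hv k⟩
  exact jointFin_lowerDecay_of_mem_Ioo hb hα hγ hαγ hA hB (hIoo u hu) (hIoo w hw1) hε1 hε2

end LocalBounds

/-! ### The rate function -/

/-- This form shows the coefficient as the limit of `α / max α β`; likewise `coefB_eq` for `β / max
α β`. -/
lemma coefA_eq (c : ℝ) : coefA c = c / max c 1 := by
  unfold coefA
  split_ifs with h
  · rw [max_eq_right h.le, div_one]
  · rw [max_eq_left (not_lt.1 h), div_self (by linarith)]

lemma coefB_eq (c : ℝ) : coefB c = 1 / max c 1 := by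
  unfold coefB
  split_ifs with h
  · rw [max_eq_left h.le, one_div]
  · rw [max_eq_right (not_lt.1 h), div_one]

lemma coefA_pos {c : ℝ} (hc : 0 < c) : 0 < coefA c := by
  rw [coefA_eq]; positivity

lemma coefB_pos (c : ℝ) : 0 < coefB c := by
  rw [coefB_eq]; positivity

lemma cost_eq_extCost (c : ℝ) {m : ℕ} {u w : Fin m → unitInterval} (hu : ∀ k, (u k : ℝ) < 1) :
    cost c u w = extCost (coefA c) (coefB c) u w := by
  refine Finset.sum_congr rfl fun k _ => ?_
  rw [binEntropy_eq_coe (u := 0) (fun _ => rfl) (fun h => absurd h (hu k).ne), Icc.coe_zero,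
    klReal_zero_left, ← EReal.coe_mul, one_div, Real.log_inv]

lemma extCost_eq_top {a b : ℝ} (ha : 0 < a) (hb : 0 ≤ b) {m : ℕ} {u w : Fin m → unitInterval}
    {k : Fin m} (hk : (u k : ℝ) = 1) : extCost a b u w = ⊤ := by
  have hterm : ∀ k : Fin m, ((b * ∏ j ∈ Finset.Iio k, (1 - (u j : ℝ)) : ℝ) : EReal) *
      binEntropy (u k) (w k) ≠ ⊥ := fun k =>
    coe_mul_ne_bot (mul_nonneg hb (prod_one_sub_nonneg u _)) (binEntropy_ne_bot _ _)
  refine sum_ereal_eq_top (fun j _ => ?_) (Finset.mem_univ k) ?_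
  · rw [EReal.add_ne_bot_iff]
    exact ⟨coe_mul_ne_bot ha.le (binEntropy_ne_bot _ _), hterm j⟩
  · rw [binEntropy_eq_top_of_eq_one hk (by simp), EReal.coe_mul_top_of_pos ha,
      EReal.top_add_of_ne_bot (hterm k)]

/-- Dropping the constraint `u k < 1` is harmless since such points cost `⊤`. The compactness
argument for the upper bound needs this inequality on the whole closed fibre of `stick`. -/
lemma rateFin_le_extCost {c : ℝ} (hc : 0 < c) {m : ℕ} (u w : Fin m → unitInterval) :
    rateFin c m (stick w) ≤ extCost (coefA c) (coefB c) u w := by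
  by_cases hu : ∀ k, (u k : ℝ) < 1
  · exact sInf_le ⟨u, w, hu, rfl, (cost_eq_extCost c hu).symm⟩
  · push Not at hu
    obtain ⟨k, hk⟩ := hu
    rw [extCost_eq_top (coefA_pos hc) (coefB_pos c).le ((u k).2.2.antisymm hk)]
    exact le_top

lemma binEntropy_ne_top_of_cost {c : ℝ} (hc : 0 < c) {m : ℕ} {u w : Fin m → unitInterval}
    (hu : ∀ k, (u k : ℝ) < 1) (h : cost c u w ≠ ⊤) (k : Fin m) : binEntropy (u k) (w k) ≠ ⊤ := by
  intro htop
  refine h ?_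
  rw [cost_eq_extCost c hu]
  refine sum_ereal_eq_top (fun j _ => ?_) (Finset.mem_univ k) ?_
  · rw [EReal.add_ne_bot_iff]
    exact ⟨coe_mul_ne_bot (coefA_pos hc).le (binEntropy_ne_bot _ _), coe_mul_ne_bot
      (mul_nonneg (coefB_pos c).le (prod_one_sub_nonneg u _)) (binEntropy_ne_bot _ _)⟩
  · rw [htop, EReal.coe_mul_top_of_pos (mul_pos (coefB_pos c)
      (Finset.prod_pos fun j _ => sub_pos.2 (hu j))), EReal.add_top_of_ne_bot]
    exact coe_mul_ne_bot (coefA_pos hc).le (binEntropy_ne_bot _ _)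

lemma cost_eq_realCost {c : ℝ} {m : ℕ} {u w : Fin m → unitInterval} (hu : ∀ k, (u k : ℝ) < 1)
    (h : ∀ k, binEntropy (u k) (w k) ≠ ⊤) :
    cost c u w = (realCost (coefA c) (coefB c) u w : EReal) := by
  rw [cost_eq_extCost c hu, extCost, realCost, ← sum_ereal_coe]
  refine Finset.sum_congr rfl fun k _ => ?_
  rw [binEntropy_eq_coe (u := 0) (fun _ => rfl) (fun h => absurd h (hu k).ne),
    binEntropy_eq_coe (eq_of_binEntropy_ne_top (h k)).1 (eq_of_binEntropy_ne_top (h k)).2,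
    ← EReal.coe_mul, ← EReal.coe_mul, ← EReal.coe_add]
  rfl

lemma continuous_stick_fin (m : ℕ) :
    Continuous fun w : Fin m → unitInterval => (stick w : Fin m → ℝ) := by
  unfold stick
  fun_prop

/-! ### The infinite simplex is compact -/

/-- The total sum is not continuous in the product topology, but its being at most one is equivalent
to closed conditions on the partial sums. -/
lemma isCompact_simplexInf : IsCompact simplexInf := by
  have h1 : simplexInf = (univ.pi fun _ : ℕ => Icc (0 : ℝ) 1) ∩
      ⋂ n : ℕ, {p | ∑ i ∈ Finset.range n, p i ≤ 1} := by
    ext p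
    simp only [simplexInf, mem_ofPred_eq, mem_inter_iff, mem_univ_pi, mem_iInter]
    refine ⟨fun ⟨h1, h2, h3⟩ => ⟨h1, fun n =>
      (h2.sum_le_tsum _ fun i _ => (h1 i).1).trans h3⟩, fun ⟨h1, h2⟩ => ⟨h1, ?_, ?_⟩⟩
    · exact summable_of_sum_range_le (fun i => (h1 i).1) h2
    · exact Real.tsum_le_of_sum_range_le (fun i => (h1 i).1) h2
  rw [h1]
  refine (isCompact_univ_pi fun _ => isCompact_Icc).inter_right (isClosed_iInter fun n => ?_)
  exact isClosed_le (by fun_prop) continuous_const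

instance : CompactSpace simplexInf := isCompact_iff_compactSpace.1 isCompact_simplexInf

/-! ### Local bounds for the law of the HDP mass -/

section HDPBounds

variable {ι : Type*} {l : Filter ι} {α β γ : ι → ℝ} {c : ℝ}

lemma hdpMassLaw_upperDecay (hc : 0 < c) (hα : Tendsto α l atTop)
    (hγ : Tendsto γ l atTop) (hA : Tendsto (fun i => α i / γ i) l (𝓝 (coefA c)))
    (hB : Tendsto (fun i => β i / γ i) l (𝓝 (coefB c))) {z : simplexInf} {M : ℝ}
    (hM : (M : EReal) < rate c z) :
    ∃ N ∈ 𝓝 z, UpperDecay l (fun i => hdpMassLaw (α i) (β i)) γ N M := by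
  obtain ⟨m, hm⟩ := lt_iSup_iff.1 hM
  obtain ⟨-, hm⟩ := lt_iSup_iff.1 hm
  let φ : (Fin m → unitInterval) × (Fin m → unitInterval) → Fin m → ℝ := fun p => stick p.2
  have hφ : Continuous φ := (continuous_stick_fin m).comp continuous_snd
  set zm : Fin m → ℝ := fun k => z.1 k with hzm
  have hloc : ∀ p ∈ φ ⁻¹' {zm}, ∃ N, IsOpen N ∧ p ∈ N ∧
      UpperDecay l (fun i => jointFin m (α i) (β i)) γ N M := fun p hp =>
    jointFin_upperDecay (coefA_pos hc) (coefB_pos c) hα hγ hA hB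
      (hm.trans_le ((congrArg (rateFin c m) (show φ p = zm from hp)).symm.le.trans
        (rateFin_le_extCost hc p.1 p.2)))
  choose! N hNo hpN hdec using hloc
  have hK : IsCompact (φ ⁻¹' {zm}) := (isClosed_singleton.preimage hφ).isCompact
  obtain ⟨t, ht, hcov⟩ :=
    hK.elim_nhds_subcover N fun p hp => (hNo p hp).mem_nhds (hpN p hp)
  have hO : IsOpen (⋃ p ∈ t, N p) := isOpen_biUnion fun p hp => hNo p (ht p hp)
  -- Tube argument: `φ` is closed because its domain is compact, so a neighbourhood of the fibre
  -- contains the preimage of a neighbourhood of `zm`.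
  have hV : IsOpen (φ '' (⋃ p ∈ t, N p)ᶜ)ᶜ :=
    (hφ.isClosedMap _ hO.isClosed_compl).isOpen_compl
  have hzV : zm ∈ (φ '' (⋃ p ∈ t, N p)ᶜ)ᶜ := by
    rintro ⟨p, hp, hpz⟩
    exact hp (hcov hpz)
  have hsub : {p | φ p ∈ (φ '' (⋃ p ∈ t, N p)ᶜ)ᶜ} ⊆ ⋃ p ∈ t, N p := fun p hp =>
    by_contra fun h => hp ⟨p, h, rfl⟩
  obtain ⟨C, hC, hev⟩ := (UpperDecay.biUnion t fun p hp => hdec p (ht p hp)).mono hsub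
  refine ⟨{z' | (fun k : Fin m => z'.1 k) ∈ (φ '' (⋃ p ∈ t, N p)ᶜ)ᶜ}, ?_, C, hC, ?_⟩
  · have hcont : Continuous fun z' : simplexInf => (fun k : Fin m => z'.1 k) :=
      continuous_pi fun k => (continuous_apply (k : ℕ)).comp continuous_subtype_val
    exact (hV.preimage hcont).mem_nhds hzV
  · filter_upwards [hev] with i hi
    rw [hdpMassLaw_setOf _ _ hV]
    exact hi

lemma hdpMassLaw_lowerDecay (hc : 0 < c) (hα : Tendsto α l atTop)
    (hγ : Tendsto γ l atTop) (hαγ : ∀ i, α i ≤ γ i)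
    (hA : Tendsto (fun i => α i / γ i) l (𝓝 (coefA c)))
    (hB : Tendsto (fun i => β i / γ i) l (𝓝 (coefB c))) {z : simplexInf} {M : ℝ}
    (hM : rate c z < M) {N : Set simplexInf} (hN : N ∈ 𝓝 z) :
    LowerDecay l (fun i => hdpMassLaw (α i) (β i)) γ N M := by
  obtain ⟨N₀, hN₀, hN₀N⟩ := mem_nhds_subtype _ _ _ |>.1 hN
  rw [nhds_pi, Filter.mem_pi] at hN₀
  obtain ⟨I, hI, t, ht, htN⟩ := hN₀
  obtain ⟨n, hn⟩ := hI.bddAbove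
  -- Indices start at `0`, so `m` coordinates cover all constrained indices up to `n`; also `1 ≤ m`,
  -- as the supremum defining the rate requires.
  let m := n + 1
  have hV : IsOpen (univ.pi fun k : Fin m => interior (t k)) :=
    isOpen_set_pi finite_univ fun k _ => isOpen_interior
  have hVN : {z' : simplexInf | (fun k : Fin m => z'.1 k) ∈
      univ.pi fun k : Fin m => interior (t k)} ⊆ N := fun z' hz' =>
    hN₀N (htN fun i hi => interior_subset
      (hz' ⟨i, Nat.lt_succ_of_le (hn hi)⟩ (mem_univ _)))
  have hm : rateFin c m (fun k : Fin m => z.1 k) < M :=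
    (le_iSup₂_of_le (f := fun (m : ℕ) (_ : 1 ≤ m) => rateFin c m fun k : Fin m => z.1 k)
      m (Nat.le_add_left 1 n) le_rfl).trans_lt hM
  obtain ⟨_, ⟨u, w, hu, hwz, rfl⟩, hcost⟩ := sInf_lt_iff.1 hm
  have hfin := binEntropy_ne_top_of_cost hc hu hcost.ne_top
  rw [cost_eq_realCost hu hfin, EReal.coe_lt_coe_iff] at hcost
  -- At finite cost `w k = 1` would force `u k = 1`, which is excluded.
  have hw1 : ∀ k, (w k : ℝ) < 1 := fun k => lt_of_le_of_ne (w k).2.2 fun h =>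
    (hu k).ne ((eq_of_binEntropy_ne_top (hfin k)).2 h)
  have hpre : {p : (Fin m → unitInterval) × (Fin m → unitInterval) | stick p.2 ∈
      univ.pi fun k : Fin m => interior (t k)} ∈ 𝓝 (u, w) := by
    refine (hV.preimage ((continuous_stick_fin m).comp continuous_snd)).mem_nhds ?_
    change stick w ∈ univ.pi fun k : Fin m => interior (t k)
    rw [hwz]
    exact fun k _ => mem_interior_iff_mem_nhds.2 (ht k)
  obtain ⟨C, hC, hev⟩ := jointFin_lowerDecay (coefB_pos c) hα hγ hαγ hA hB hu
    (fun k => (eq_of_binEntropy_ne_top (hfin k)).1) hw1 hcost hpre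
  refine LowerDecay.mono ⟨C, hC, ?_⟩ hVN
  filter_upwards [hev] with i hi
  rw [hdpMassLaw_setOf _ _ hV]
  exact hi

end HDPBounds

end HDP

end

theorem theorem3p2 {c : ℝ} (hc : 0 < c) {ι : Type*} (l : Filter ι) [l.NeBot]
    (α β : ι → ℝ) (hα_pos : ∀ i, 0 < α i) (hβ_pos : ∀ i, 0 < β i)
    (hα : Tendsto α l atTop) (hβ : Tendsto β l atTop)
    (hαβ : Tendsto (fun i => α i / β i) l (𝓝 c)) :
    HDP.SatisfiesLDP l (fun i => HDP.hdpMassLaw (α i) (β i)) (fun i => max (α i) (β i))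
      (HDP.rate c) := by
  have hγ : Tendsto (fun i => max (α i) (β i)) l atTop :=
    tendsto_atTop_mono (fun i => le_max_left _ _) hα
  -- Dividing numerator and denominator by `β` expresses both ratios to the speed through `α / β`,
  -- so their limits follow from that of `α / β`.
  have hmax : ∀ i, max (α i / β i) 1 = max (α i) (β i) / β i := fun i => by
    rw [← max_div_div_right (hβ_pos i).le, div_self (hβ_pos i).ne']
  have h1 : Tendsto (fun i => max (α i / β i) 1) l (𝓝 (max c 1)) := hαβ.max tendsto_const_nhds
  have hc1 : max c 1 ≠ 0 := (lt_max_of_lt_left hc).ne'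
  have hA : Tendsto (fun i => α i / max (α i) (β i)) l (𝓝 (HDP.coefA c)) := by
    rw [HDP.coefA_eq]
    refine (hαβ.div h1 hc1).congr fun i => ?_
    rw [Pi.div_apply, hmax, div_div_div_cancel_right₀ (hβ_pos i).ne']
  have hB : Tendsto (fun i => β i / max (α i) (β i)) l (𝓝 (HDP.coefB c)) := by
    rw [HDP.coefB_eq]
    refine ((tendsto_const_nhds (x := (1 : ℝ))).div h1 hc1).congr fun i => ?_
    rw [Pi.div_apply, hmax, one_div_div]
  exact HDP.satisfiesLDP_of_local hγ
    (fun z M hM => HDP.hdpMassLaw_upperDecay hc hα hγ hA hB hM)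
    (fun z M hM N hN => HDP.hdpMassLaw_lowerDecay hc hα hγ (fun i => le_max_left _ _) hA hB hM hN)
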